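/- A \emph{Pisot number} is a real algebraic integer $\theta>1$ all of whose other conjugates have modulus less than $1$. For $\theta>1$ let $$\mu_\theta=\mathop{\ast}_{k\ge 0}\Bigl(\tfrac12\delta_{-\theta^{-k}}+\tfrac12\delta_{\theta^{-k}}\Bigr)$$ be the Bernoulli convolution, i.e. the distribution of the random series $\sum_{k\ge0}\pm\theta^{-k}$ with independent fair signs. Regard it as a Borel probability measure on the circle $S^1=\mathbb{R}/\mathbb{Z}$ (by reduction modulo $1$), with Fourier coefficients $$\widehat{\mu_\theta}(n)=\int e^{-2\pi i n x}\,d\mu_\theta(x)=\prod_{k\ge0}\cos(2\pi\theta^{-k}n),\qquad n\in\mathbb{Z}.$$ For $1\le p\le\infty$ let $T_{\mu_\theta}$ be the bounded operator $f\mapsto\mu_\theta*f$, $(\mu_\theta*f)(x)=\int f(x-y)\,d\mu_\theta(y)$, on the complex space $L^p(S^1)$, and let $\mathrm{sp}(T_{\mu_\theta},L^p)$ be its spectrum. Let $\theta$ be an irrational Pisot number. Then the set of limit points of the sequence $(\widehat{\mu_\theta}(n))_{n\in\mathbb{Z}}$ (the points every neighbourhood of which contains $\widehat{\mu_\theta}(n)$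 for infinitely many $n$) is countably infinite, and for every $1<p<\infty$ $$\mathrm{sp}(T_{\mu_\theta},L^p)=\mathrm{sp}(T_{\mu_\theta},L^2)=\overline{\{\widehat{\mu_\theta}(n):n\in\mathbb{Z}\}}.$$ -/

import Mathlib

open MeasureTheory Filter Topology AddCircle
open scoped ENNReal

noncomputable section

namespace BernoulliConv

/-- A Pisot number: a real algebraic integer `θ > 1` all of whose other conjugates
(complex roots of its minimal polynomial) have modulus less than `1`. -/
def IsPisot (θ : ℝ) : Prop :=
  1 < θ ∧ IsIntegral ℤ θ ∧ ∀ z ∈ (minpoly ℚ θ).aroots ℂ, z ≠ (θ : ℂ) → ‖z‖ < 1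

/-- The law of a sequence of independent fair coin tosses. -/
def coinTosses : Measure (ℕ → Bool) :=
  Measure.infinitePi fun _ => (PMF.uniformOfFintype Bool).toMeasure

instance : IsProbabilityMeasure coinTosses := by
  unfold coinTosses; infer_instance

/-- The sign `±1` encoded by a coin toss. -/
def sign (b : Bool) : ℝ := if b then 1 else -1

/-- The random series `∑ₖ ± θ⁻ᵏ`. -/
def randomSeries (θ : ℝ) (ω : ℕ → Bool) : ℝ := ∑' k : ℕ, sign (ω k) * θ⁻¹ ^ k

/-- The Bernoulli convolution on the line, i.e. the infinite convolution over `k ≥ 0` of the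
measures `(δ_{-θ⁻ᵏ} + δ_{θ⁻ᵏ}) / 2`: the law of a sum of independent random variables having
these laws. -/
def bernoulliConvolution (θ : ℝ) : Measure ℝ := coinTosses.map (randomSeries θ)

/-- The measure induced on the circle `ℝ / ℤ`. -/
def circleBernoulli (θ : ℝ) : Measure UnitAddCircle :=
  (bernoulliConvolution θ).map (fun x : ℝ => (x : UnitAddCircle))

theorem abs_sign (b : Bool) : |sign b| = 1 := by cases b <;> simp [sign]

theorem measurable_randomSeries (θ : ℝ) : Measurable (randomSeries θ) := by
  have hs : ∀ (ω : ℕ → Bool) (k : ℕ), ‖sign (ω k) * θ⁻¹ ^ k‖ = |θ⁻¹| ^ k := fun ω k => by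
    rw [norm_mul, Real.norm_eq_abs, abs_sign, one_mul, norm_pow, Real.norm_eq_abs]
  by_cases h : |θ⁻¹| < 1
  · refine Continuous.measurable (continuous_tsum (u := fun k => |θ⁻¹| ^ k) (fun k => ?_)
      (summable_geometric_of_lt_one (abs_nonneg _) h) (fun k ω => (hs ω k).le))
    exact ((continuous_of_discreteTopology (f := sign)).comp (continuous_apply k)).mul
      continuous_const
  · have : randomSeries θ = fun _ => 0 := by
      funext ω
      refine tsum_eq_zero_of_not_summable fun hsum => h ?_
      have h1 := hsum.norm
      simp only [hs] at h1
      simpa using summable_geometric_iff_norm_lt_one.1 h1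
    rw [this]
    exact measurable_const

instance (θ : ℝ) : IsProbabilityMeasure (bernoulliConvolution θ) :=
  Measure.isProbabilityMeasure_map (measurable_randomSeries θ).aemeasurable

instance (θ : ℝ) : IsProbabilityMeasure (circleBernoulli θ) :=
  Measure.isProbabilityMeasure_map (AddCircle.measurable_mk').aemeasurable

/-- The `n`-th Fourier coefficient `∫ e^{-2πinx} dν(x)` of a measure on the circle. -/
def measureFourierCoeff (ν : Measure UnitAddCircle) (n : ℤ) : ℂ := ∫ x, fourier (-n) x ∂ν

/-- The Fourier coefficients of the Bernoulli convolution are `∏_{k ≥ 0} cos (2π θ⁻ᵏ n)`. -/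
theorem tendsto_prod_cos {θ : ℝ} (hθ : 1 < θ) (n : ℤ) :
    Tendsto (fun N : ℕ => ∏ k ∈ Finset.range N, (Real.cos (2 * Real.pi * θ⁻¹ ^ k * n) : ℂ)) atTop
      (𝓝 (measureFourierCoeff (circleBernoulli θ) n)) := by
  let e : ℝ → ℂ := fun x => Complex.exp (-(2 * Real.pi * n * x) * Complex.I)
  have hc : Continuous e := by fun_prop
  have hm : ∀ k : ℕ, Measurable fun b : Bool => e (sign b * θ⁻¹ ^ k) :=
    fun k => measurable_of_countable _
  have h0 : measureFourierCoeff (circleBernoulli θ) n =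
      ∫ ω, e (randomSeries θ ω) ∂coinTosses := by
    unfold measureFourierCoeff circleBernoulli bernoulliConvolution
    rw [integral_map AddCircle.measurable_mk'.aemeasurable
      (fourier (-n)).continuous.aestronglyMeasurable,
      integral_map (f := fun x : ℝ => fourier (-n) (x : UnitAddCircle))
        (measurable_randomSeries θ).aemeasurable
        ((fourier (-n)).continuous.comp (AddCircle.continuous_mk' 1)).aestronglyMeasurable]
    congr 1; funext ω
    rw [fourier_coe_apply]; congr 1; push_cast; ring
  have hpart : ∀ N : ℕ, (∏ k ∈ Finset.range N, (Real.cos (2 * Real.pi * θ⁻¹ ^ k * n) : ℂ)) =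
      ∫ ω, ∏ k ∈ Finset.range N, e (sign (ω k) * θ⁻¹ ^ k) ∂coinTosses := by
    intro N
    have hi := ProbabilityTheory.iIndepFun_infinitePi
      (P := fun _ : ℕ => (PMF.uniformOfFintype Bool).toMeasure)
      (X := fun (k : ℕ) b => e (sign b * θ⁻¹ ^ k)) hm
    have h1 := (hi.precomp (g := fun i : Fin N => (i : ℕ))
      Fin.val_injective).integral_fun_prod_eq_prod_integral
      (fun i => ((hm i).comp (measurable_pi_apply _)).aestronglyMeasurable)
    simp only [Finset.prod_range]
    refine Eq.trans (Finset.prod_congr rfl fun i _ => ?_) h1.symm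
    refine Eq.trans ?_ (integral_map (μ := coinTosses) (φ := fun ω => ω (i : ℕ))
      (measurable_pi_apply _).aemeasurable (hm i).aestronglyMeasurable)
    rw [coinTosses, Measure.infinitePi_map_eval, PMF.integral_eq_sum]
    simp [e, sign, Complex.cos]
    ring_nf
  rw [h0]
  simp only [hpart]
  refine tendsto_integral_of_dominated_convergence (fun _ => 1) (fun N => ?_)
    (integrable_const _) (fun N => ?_) ?_
  · exact (Finset.measurable_fun_prod _ fun k _ =>
      (hm k).comp (measurable_pi_apply k)).aestronglyMeasurable
  · filter_upwards with ω
    rw [norm_prod]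
    refine Finset.prod_le_one (fun _ _ => norm_nonneg _) fun k _ => le_of_eq ?_
    simp only [e]
    rw [Complex.norm_exp]
    simp [← Complex.ofReal_pow, ← Complex.ofReal_mul]
  · filter_upwards with ω
    have hs : Summable (fun k => sign (ω k) * θ⁻¹ ^ k) := by
      refine Summable.of_norm ?_
      have : (fun k => ‖sign (ω k) * θ⁻¹ ^ k‖) = fun k => θ⁻¹ ^ k := by
        funext k
        rw [norm_mul, Real.norm_eq_abs, abs_sign, one_mul, Real.norm_of_nonneg (by positivity)]
      rw [this]
      exact summable_geometric_of_lt_one (by positivity) (inv_lt_one_of_one_lt₀ hθ)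
    refine ((hc.tendsto _).comp hs.hasSum.tendsto_sum_nat).congr fun N => ?_
    simp only [Function.comp, e, ← Complex.exp_sum]
    push_cast
    rw [Finset.mul_sum, ← Finset.sum_neg_distrib, Finset.sum_mul]

/-- The limit points of a doubly infinite sequence: the points every neighbourhood of which
contains `a n` for infinitely many indices `n`. -/
def limitPoints (a : ℤ → ℂ) : Set ℂ := {z | ∀ U ∈ 𝓝 z, {n : ℤ | a n ∈ U}.Infinite}

/-- The convolution of a measure and a function on the circle. -/
def conv (ν : Measure UnitAddCircle) (f : UnitAddCircle → ℂ) (x : UnitAddCircle) : ℂ :=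
  ∫ y, f (x - y) ∂ν

/-- Complex `L^p` of the circle, with respect to the normalized Lebesgue measure. -/
abbrev CircleLp (p : ℝ≥0∞) := Lp ℂ p (haarAddCircle : Measure UnitAddCircle)

section Convolution

variable (ν : Measure UnitAddCircle) [IsProbabilityMeasure ν]

theorem measurePreserving_diff :
    MeasurePreserving (fun z : UnitAddCircle × UnitAddCircle => z.1 - z.2)
      (haarAddCircle.prod ν) haarAddCircle :=
  measurePreserving_fst.comp (measurePreserving_sub_prod haarAddCircle ν)

variable {ν}

theorem conv_congr {f g : UnitAddCircle → ℂ} (h : f =ᵐ[haarAddCircle] g) :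
    conv ν f =ᵐ[haarAddCircle] conv ν g := by
  have h1 := Measure.ae_ae_of_ae_prod
    ((measurePreserving_diff ν).quasiMeasurePreserving.ae_eq_comp h)
  filter_upwards [h1] with x hx
  exact integral_congr_ae hx

theorem memLp_diff {p : ℝ≥0∞} {f : UnitAddCircle → ℂ} (hf : MemLp f p haarAddCircle) :
    MemLp (fun z : UnitAddCircle × UnitAddCircle => f (z.1 - z.2)) p (haarAddCircle.prod ν) :=
  hf.comp_measurePreserving (measurePreserving_diff ν)

theorem ae_integrable_diff {p : ℝ≥0∞} (hp : 1 ≤ p) {f : UnitAddCircle → ℂ}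
    (hf : MemLp f p haarAddCircle) :
    ∀ᵐ x ∂(haarAddCircle : Measure UnitAddCircle), Integrable (fun y => f (x - y)) ν :=
  ((memLp_diff (ν := ν) hf).integrable hp).prod_right_ae

theorem eLpNorm_conv_le {p : ℝ≥0∞} (hp : 1 ≤ p) {f : UnitAddCircle → ℂ}
    (hf : MemLp f p haarAddCircle) :
    eLpNorm (conv ν f) p haarAddCircle ≤ eLpNorm f p haarAddCircle := by
  have hF := memLp_diff (ν := ν) hf
  have hn := eLpNorm_comp_measurePreserving (p := p) hf.1 (measurePreserving_diff ν)
  rcases eq_or_ne p ∞ with rfl | hpt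
  · rw [eLpNorm_exponent_top, eLpNorm_exponent_top]
    rw [eLpNorm_exponent_top, eLpNorm_exponent_top] at hn
    refine eLpNormEssSup_le_of_ae_enorm_bound ?_
    have h1 := Measure.ae_ae_of_ae_prod (enorm_ae_le_eLpNormEssSup
      (f ∘ fun z : UnitAddCircle × UnitAddCircle => z.1 - z.2) (haarAddCircle.prod ν))
    rw [hn] at h1
    filter_upwards [h1] with x hx
    refine (enorm_integral_le_lintegral_enorm _).trans ?_
    refine (lintegral_mono_ae hx).trans ?_
    simp
  · have hp0 : p ≠ 0 := (zero_lt_one.trans_le hp).ne'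
    have hpos : 0 < p.toReal := ENNReal.toReal_pos hp0 hpt
    rw [← hn, eLpNorm_eq_lintegral_rpow_enorm_toReal hp0 hpt,
      eLpNorm_eq_lintegral_rpow_enorm_toReal hp0 hpt]
    refine ENNReal.rpow_le_rpow ?_ (by positivity)
    simp only [Function.comp_apply]
    rw [lintegral_prod _ (hF.1.enorm.pow_const _)]
    refine lintegral_mono_ae ?_
    filter_upwards [ae_integrable_diff (ν := ν) hp hf] with x hx
    calc ‖conv ν f x‖ₑ ^ p.toReal
        ≤ (eLpNorm (fun y => f (x - y)) 1 ν) ^ p.toReal := by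
          rw [eLpNorm_one_eq_lintegral_enorm]
          exact ENNReal.rpow_le_rpow (enorm_integral_le_lintegral_enorm _) hpos.le
      _ ≤ (eLpNorm (fun y => f (x - y)) p ν) ^ p.toReal :=
          ENNReal.rpow_le_rpow (eLpNorm_le_eLpNorm_of_exponent_le hp hx.1) hpos.le
      _ = _ := by
          rw [eLpNorm_eq_lintegral_rpow_enorm_toReal hp0 hpt, ← ENNReal.rpow_mul,
            one_div, inv_mul_cancel₀ hpos.ne', ENNReal.rpow_one]

theorem memLp_conv {p : ℝ≥0∞} (hp : 1 ≤ p) {f : UnitAddCircle → ℂ}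
    (hf : MemLp f p haarAddCircle) : MemLp (conv ν f) p haarAddCircle :=
  ⟨(memLp_diff (ν := ν) hf).1.integral_prod_right',
    (eLpNorm_conv_le hp hf).trans_lt hf.2⟩

end Convolution

/-- The convolution operator `f ↦ ν * f` on `L^p` of the circle. -/
def convOp (ν : Measure UnitAddCircle) [IsProbabilityMeasure ν] (p : ℝ≥0∞) [hp : Fact (1 ≤ p)] :
    CircleLp p →L[ℂ] CircleLp p :=
  LinearMap.mkContinuous
    { toFun := fun f => (memLp_conv (ν := ν) hp.out (Lp.memLp f)).toLp (conv ν f)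
      map_add' := fun f g => by
        rw [← MemLp.toLp_add, MemLp.toLp_eq_toLp_iff]
        refine (conv_congr (Lp.coeFn_add f g)).trans ?_
        filter_upwards [ae_integrable_diff (ν := ν) hp.out (Lp.memLp f),
          ae_integrable_diff (ν := ν) hp.out (Lp.memLp g)] with x h1 h2
        exact integral_add h1 h2
      map_smul' := fun c f => by
        rw [RingHom.id_apply, ← MemLp.toLp_const_smul, MemLp.toLp_eq_toLp_iff]
        refine (conv_congr (Lp.coeFn_smul c f)).trans ?_
        filter_upwards with x
        exact integral_const_mul c _ }
    1 fun f => by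
      rw [one_mul]
      change ‖(memLp_conv (ν := ν) hp.out (Lp.memLp f)).toLp (conv ν f)‖ ≤ ‖f‖
      rw [Lp.norm_toLp, Lp.norm_def]
      exact ENNReal.toReal_mono (Lp.eLpNorm_ne_top f) (eLpNorm_conv_le hp.out (Lp.memLp f))

/-- The convolution operator is given almost everywhere by the convolution integral. -/
theorem coeFn_convOp (ν : Measure UnitAddCircle) [IsProbabilityMeasure ν] (p : ℝ≥0∞)
    [hp : Fact (1 ≤ p)] (f : CircleLp p) : convOp ν p f =ᵐ[haarAddCircle] conv ν f :=
  (memLp_conv (ν := ν) hp.out (Lp.memLp f)).coeFn_toLp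

end BernoulliConv

end

/-!
On `L^2` the operator is diagonal in the Fourier basis, so its spectrum is the closure `K` of the
coefficients, and on every `L^p` the characters are eigenfunctions, so the spectrum contains `K`.
If `K` is countable, it has capacity zero: there are monic polynomials `g`, with roots in `K`, for
which `sup_K |g| ^ (1 / deg g)` is arbitrarily small. Interpolating `g(T)` between `L^2`, where
its norm is at most `sup_K |g|`, and a space `L^1` or `L^r`, where its norm is at most exponential
in the degree, shows that no point off `K` is in the spectrum on `L^p`.

The coefficient at `n` is the product `∏ cos (π u k)` with `u k = 2 n θ ^ (-k)`, which is
unchanged when even integers are subtracted from the `u k`, and changes at most its sign for odd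
ones. Let `N j` be the trace of `θ ^ j` over `ℚ`. The Pisot property makes `θ ^ j - N j` summable,
whence the coefficients at `m + N j` tend to the coefficient at `m` times a constant `Φ` as `j →
∞`. So all `Φ ^ (r + 1)` are limit points, and `0 < |Φ| < 1` if `θ` is irrational.

For countability, subtract from the `u k` the nearest integers. The errors solve the linear
recurrence of the minimal polynomial up to integer right-hand sides, which are bounded, and sparse
as soon as the coefficient is bounded away from `0`: the errors are essentially integer
combinations of boundedly many translates of one summable Green function. Along an ultrafilter in
`n` the translates group into clusters drifting apart, each of a fixed shape, and the product
decouples into one factor for each cluster. There are only countably many shapes.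
-/

noncomputable section

namespace BernoulliConv

/-! ### Real interpolation -/

section RealInterpolation

variable {α β : Type*} [MeasurableSpace α] [MeasurableSpace β]

theorem setLIntegral_Iio_rpow {s y : ℝ} (hs : -1 < s) (hy : 0 ≤ y) :
    ∫⁻ t in Set.Iio y, ENNReal.ofReal (t ^ s) ∂volume.restrict (Set.Ioi 0) =
      ENNReal.ofReal (y ^ (s + 1) / (s + 1)) := by
  have hint : IntervalIntegrable (fun t : ℝ => t ^ s) volume 0 y :=
    intervalIntegral.intervalIntegrable_rpow' hs
  have hnonneg : 0 ≤ᵐ[volume.restrict (Set.Ioc 0 y)] fun t : ℝ => t ^ s := by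
    filter_upwards [ae_restrict_mem measurableSet_Ioc] with t ht
    exact Real.rpow_nonneg ht.1.le s
  rw [Measure.restrict_restrict measurableSet_Iio, Set.Iio_inter_Ioi, restrict_Ioo_eq_restrict_Ioc,
    ← ofReal_integral_eq_lintegral_ofReal
      ((intervalIntegrable_iff_integrableOn_Ioc_of_le hy).1 hint)
      hnonneg, ← intervalIntegral.integral_of_le hy, integral_rpow (Or.inl hs),
    Real.zero_rpow (by linarith), sub_zero]

theorem setLIntegral_Ici_rpow {s y : ℝ} (hs : s < -1) (hy : 0 < y) :
    ∫⁻ t in Set.Ici y, ENNReal.ofReal (t ^ s) ∂volume.restrict (Set.Ioi 0) =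
      ENNReal.ofReal (-y ^ (s + 1) / (s + 1)) := by
  have hnonneg : 0 ≤ᵐ[volume.restrict (Set.Ioi y)] fun t : ℝ => t ^ s := by
    filter_upwards [ae_restrict_mem measurableSet_Ioi] with t ht
    exact Real.rpow_nonneg (hy.trans ht).le s
  rw [Measure.restrict_restrict measurableSet_Ici,
    Set.inter_eq_left.2 (Set.Ici_subset_Ioi.2 hy), ← restrict_Ioi_eq_restrict_Ici,
    ← ofReal_integral_eq_lintegral_ofReal (integrableOn_Ioi_rpow_of_lt hs hy) hnonneg,
    integral_Ioi_rpow_of_lt hs hy]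

theorem lintegral_setLIntegral_swap {μ : Measure α} {ν : Measure β} [SFinite μ] [SFinite ν]
    {k : α → β → ℝ≥0∞} (hk : Measurable (Function.uncurry k)) {P : α → β → Prop}
    (hP : MeasurableSet {z : α × β | P z.1 z.2}) :
    ∫⁻ a, ∫⁻ b in {b | P a b}, k a b ∂ν ∂μ = ∫⁻ b, ∫⁻ a in {a | P a b}, k a b ∂μ ∂ν := by
  have hleft (a : α) : ∫⁻ b in {b | P a b}, k a b ∂ν =
      ∫⁻ b, {z : α × β | P z.1 z.2}.indicator (Function.uncurry k) (a, b) ∂ν :=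
    (lintegral_indicator (measurable_prodMk_left hP) _).symm
  have hright (b : β) : ∫⁻ a in {a | P a b}, k a b ∂μ =
      ∫⁻ a, {z : α × β | P z.1 z.2}.indicator (Function.uncurry k) (a, b) ∂μ :=
    (lintegral_indicator (measurable_prodMk_right hP) _).symm
  simp only [hleft, hright]
  exact lintegral_lintegral_swap (hk.indicator hP).aemeasurable

variable {μ : Measure α} {ν : Measure β} [SFinite μ] {f : α → ℝ} {p q r : ℝ}

theorem lintegral_rpow_mul_setLIntegral_lt (hf : Measurable f) (hf0 : ∀ x, 0 ≤ f x)
    (hq : 0 < q) (hqp : q < p) :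
    ∫⁻ t in Set.Ioi 0, ∫⁻ x in {x | t < f x}, ENNReal.ofReal (t ^ (p - 1 - q)) *
        ENNReal.ofReal (f x ^ q) ∂μ =
      ENNReal.ofReal (1 / (p - q)) * ∫⁻ x, ENNReal.ofReal (f x ^ p) ∂μ := by
  have hpq : 0 < p - q := sub_pos.2 hqp
  rw [lintegral_setLIntegral_swap (P := fun t x => t < f x) (by fun_prop)
    (measurableSet_lt measurable_fst (hf.comp measurable_snd)),
    ← lintegral_const_mul' _ _ ENNReal.ofReal_ne_top]
  refine lintegral_congr fun x => ?_
  rw [lintegral_mul_const' _ _ ENNReal.ofReal_ne_top]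
  refine (congrArg (· * _) (setLIntegral_Iio_rpow (by linarith) (hf0 x))).trans ?_
  rw [show p - 1 - q + 1 = p - q by ring, ← ENNReal.ofReal_mul (by have := hf0 x; positivity),
    ← ENNReal.ofReal_mul (by positivity), div_mul_eq_mul_div, one_div_mul_eq_div,
    ← Real.rpow_add_of_nonneg (hf0 x) hpq.le hq.le, sub_add_cancel]

theorem lintegral_rpow_mul_setLIntegral_ge (hf : Measurable f) (hf0 : ∀ x, 0 ≤ f x)
    (hp : 0 < p) (hpr : p < r) :
    ∫⁻ t in Set.Ioi 0, ∫⁻ x in {x | f x ≤ t}, ENNReal.ofReal (t ^ (p - 1 - r)) *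
        ENNReal.ofReal (f x ^ r) ∂μ =
      ENNReal.ofReal (1 / (r - p)) * ∫⁻ x, ENNReal.ofReal (f x ^ p) ∂μ := by
  have : 0 < r - p := sub_pos.2 hpr
  rw [lintegral_setLIntegral_swap (P := fun t x => f x ≤ t) (by fun_prop)
    (measurableSet_le (hf.comp measurable_snd) measurable_fst),
    ← lintegral_const_mul' _ _ ENNReal.ofReal_ne_top]
  refine lintegral_congr fun x => ?_
  rw [lintegral_mul_const' _ _ ENNReal.ofReal_ne_top]
  rcases (hf0 x).eq_or_lt with h0 | h0
  · simp [← h0, Real.zero_rpow hp.ne', Real.zero_rpow (hp.trans hpr).ne']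
  refine (congrArg (· * _) (setLIntegral_Ici_rpow (by linarith) h0)).trans ?_
  rw [show p - 1 - r + 1 = -(r - p) by ring, neg_div_neg_eq, ← ENNReal.ofReal_mul (by positivity),
    ← ENNReal.ofReal_mul (by positivity), div_mul_eq_mul_div, one_div_mul_eq_div,
    ← Real.rpow_add h0, neg_sub, sub_add_cancel]

theorem lintegral_rpow_le_of_meas_lt_le {F : β → ℝ} (hF : AEMeasurable F ν) (hF0 : ∀ y, 0 ≤ F y)
    (hf : Measurable f) (hf0 : ∀ x, 0 ≤ f x) (hq : 0 < q) (hqp : q < p) (hpr : p < r)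
    {a c : ℝ} (ha : 0 ≤ a) (hc : 0 ≤ c)
    (h : ∀ t > 0, ν {y | t < F y} ≤
      ENNReal.ofReal (a * t ^ (-q)) * ∫⁻ x in {x | t < f x}, ENNReal.ofReal (f x ^ q) ∂μ +
      ENNReal.ofReal (c * t ^ (-r)) * ∫⁻ x in {x | f x ≤ t}, ENNReal.ofReal (f x ^ r) ∂μ) :
    ∫⁻ y, ENNReal.ofReal (F y ^ p) ∂ν ≤
      ENNReal.ofReal (p * (a / (p - q) + c / (r - p))) * ∫⁻ x, ENNReal.ofReal (f x ^ p) ∂μ := by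
  have hp : 0 < p := hq.trans hqp
  have : 0 < p - q := sub_pos.2 hqp
  have : 0 < r - p := sub_pos.2 hpr
  have hscale {t b s : ℝ} (ht : 0 < t) (hb : 0 ≤ b) (g : α → ℝ≥0∞) (A : Set α) :
      ENNReal.ofReal (b * t ^ (-s)) * (∫⁻ x in A, g x ∂μ) * ENNReal.ofReal (t ^ (p - 1)) =
        ENNReal.ofReal b * ∫⁻ x in A, ENNReal.ofReal (t ^ (p - 1 - s)) * g x ∂μ := by
    rw [lintegral_const_mul' _ _ ENNReal.ofReal_ne_top, mul_right_comm,
      ← ENNReal.ofReal_mul (by positivity), mul_assoc b, ← Real.rpow_add ht,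
      ENNReal.ofReal_mul hb, mul_assoc, neg_add_eq_sub]
  have hmeas : Measurable fun t : ℝ => ∫⁻ x in {x | t < f x},
      ENNReal.ofReal (t ^ (p - 1 - q)) * ENNReal.ofReal (f x ^ q) ∂μ := by
    simp only [lintegral_const_mul' _ _ ENNReal.ofReal_ne_top]
    have hanti : Antitone fun t : ℝ => ∫⁻ x in {x | t < f x}, ENNReal.ofReal (f x ^ q) ∂μ :=
      fun s t hst => lintegral_mono_set fun x hx => hst.trans_lt hx
    have := hanti.measurable
    fun_prop
  calc ∫⁻ y, ENNReal.ofReal (F y ^ p) ∂ν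
      = ENNReal.ofReal p *
          ∫⁻ t in Set.Ioi 0, ν {y | t < F y} * ENNReal.ofReal (t ^ (p - 1)) :=
        lintegral_rpow_eq_lintegral_meas_lt_mul ν (Eventually.of_forall hF0) hF hp
    _ ≤ ENNReal.ofReal p * ∫⁻ t in Set.Ioi 0,
          (ENNReal.ofReal a * ∫⁻ x in {x | t < f x},
              ENNReal.ofReal (t ^ (p - 1 - q)) * ENNReal.ofReal (f x ^ q) ∂μ) +
          ENNReal.ofReal c * ∫⁻ x in {x | f x ≤ t},
              ENNReal.ofReal (t ^ (p - 1 - r)) * ENNReal.ofReal (f x ^ r) ∂μ := by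
        gcongr ENNReal.ofReal p * ?_
        refine setLIntegral_mono' measurableSet_Ioi fun t ht => ?_
        refine (mul_le_mul_left (h t ht) _).trans_eq ?_
        rw [add_mul, hscale ht ha, hscale ht hc]
    _ = _ := by
        rw [lintegral_add_left (hmeas.const_mul _), lintegral_const_mul' _ _ ENNReal.ofReal_ne_top,
          lintegral_const_mul' _ _ ENNReal.ofReal_ne_top,
          lintegral_rpow_mul_setLIntegral_lt hf hf0 hq hqp,
          lintegral_rpow_mul_setLIntegral_ge hf hf0 hp hpr, ← mul_assoc, ← mul_assoc, ← add_mul,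
          ← mul_assoc, ← ENNReal.ofReal_mul ha, ← ENNReal.ofReal_mul hc,
          ← ENNReal.ofReal_add (by positivity) (by positivity), ← ENNReal.ofReal_mul hp.le]
        simp only [mul_one_div]

end RealInterpolation

section Marcinkiewicz

variable {α β 𝕜 E F : Type*} [MeasurableSpace α] [MeasurableSpace β] {μ : Measure α}
  {ν : Measure β} [NontriviallyNormedField 𝕜] [NormedAddCommGroup E] [NormedSpace 𝕜 E]
  [NormedAddCommGroup F] [NormedSpace 𝕜 F] {p q r : ℝ≥0∞}
  [Fact (1 ≤ p)] [Fact (1 ≤ q)] [Fact (1 ≤ r)]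

/-- Two operators on different `L^p` spaces are compatible if they agree on the functions that
belong to both domains, as the realizations of one operator on the scale of `L^p` spaces do. -/
def Compatible (S : Lp E p μ →L[𝕜] Lp F p ν) (T : Lp E q μ →L[𝕜] Lp F q ν) : Prop :=
  ∀ (f : Lp E p μ) (g : Lp E q μ), f =ᵐ[μ] g → S f =ᵐ[ν] T g

theorem ofReal_norm_rpow_eq_lintegral (hp : p ≠ ∞) (f : Lp E p μ) :
    ENNReal.ofReal (‖f‖ ^ p.toReal) = ∫⁻ x, ENNReal.ofReal (‖f x‖ ^ p.toReal) ∂μ := by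
  have hp0 : p ≠ 0 := (zero_lt_one.trans_le Fact.out).ne'
  have hpos : 0 < p.toReal := ENNReal.toReal_pos hp0 hp
  rw [← ENNReal.ofReal_rpow_of_nonneg (norm_nonneg _) hpos.le, Lp.norm_def,
    ENNReal.ofReal_toReal (Lp.eLpNorm_ne_top _), eLpNorm_eq_lintegral_rpow_enorm_toReal hp0 hp,
    ← ENNReal.rpow_mul, one_div, inv_mul_cancel₀ hpos.ne', ENNReal.rpow_one]
  refine lintegral_congr fun x => ?_
  rw [← ofReal_norm, ENNReal.ofReal_rpow_of_nonneg (norm_nonneg _) hpos.le]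

theorem meas_norm_apply_ge_le (hq : q ≠ ∞) (S : Lp E q μ →L[𝕜] Lp F q ν) {A : ℝ} (hA : ‖S‖ ≤ A)
    (f : Lp E q μ) {t : ℝ} (ht : 0 < t) :
    ν {y | t ≤ ‖S f y‖} ≤
      ENNReal.ofReal ((A / t) ^ q.toReal) * ∫⁻ x, ENNReal.ofReal (‖f x‖ ^ q.toReal) ∂μ := by
  have hq0 : q ≠ 0 := (zero_lt_one.trans_le Fact.out).ne'
  have hqpos : 0 < q.toReal := ENNReal.toReal_pos hq0 hq
  have hA0 : 0 ≤ A := (norm_nonneg _).trans hA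
  have hset : {y | t ≤ ‖S f y‖} =
      {y | ENNReal.ofReal (t ^ q.toReal) ≤ ENNReal.ofReal (‖S f y‖ ^ q.toReal)} := by
    ext y
    change t ≤ ‖S f y‖ ↔ ENNReal.ofReal _ ≤ ENNReal.ofReal _
    rw [ENNReal.ofReal_le_ofReal_iff (by positivity),
      Real.rpow_le_rpow_iff ht.le (norm_nonneg _) hqpos]
  have hchebyshev : ENNReal.ofReal (t ^ q.toReal) * ν {y | t ≤ ‖S f y‖} ≤
      ENNReal.ofReal (‖S f‖ ^ q.toReal) := by
    rw [ofReal_norm_rpow_eq_lintegral hq, hset]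
    exact mul_meas_ge_le_lintegral₀
      ((Lp.aestronglyMeasurable (S f)).norm.aemeasurable.pow_const _).ennreal_ofReal _
  rw [← ofReal_norm_rpow_eq_lintegral hq, ← ENNReal.ofReal_mul (by positivity),
    ← Real.mul_rpow (by positivity) (norm_nonneg _), div_mul_eq_mul_div,
    Real.div_rpow (by positivity) ht.le, ENNReal.ofReal_div_of_pos (by positivity),
    ENNReal.le_div_iff_mul_le (by left; simpa using by positivity) (by simp), mul_comm]
  refine hchebyshev.trans (ENNReal.ofReal_le_ofReal ?_)
  gcongr
  exact S.le_of_opNorm_le hA f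

theorem lintegral_norm_toLp_indicator_rpow (hp : p ≠ ∞) {f : α → E} {I : Set α}
    (hI : MeasurableSet I) (h : MemLp (I.indicator f) p μ) :
    ∫⁻ x, ENNReal.ofReal (‖h.toLp _ x‖ ^ p.toReal) ∂μ =
      ∫⁻ x in I, ENNReal.ofReal (‖f x‖ ^ p.toReal) ∂μ := by
  have hp0 : p.toReal ≠ 0 := (ENNReal.toReal_pos (zero_lt_one.trans_le Fact.out).ne' hp).ne'
  rw [← lintegral_indicator hI]
  refine lintegral_congr_ae ?_
  filter_upwards [h.coeFn_toLp] with x hx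
  by_cases hxI : x ∈ I <;> simp [hx, hxI, hp0]

theorem meas_norm_gt_le_add_of_ae_eq_add {u v w : β → F} (h : w =ᵐ[ν] fun y => u y + v y) (t : ℝ) :
    ν {y | t < ‖w y‖} ≤ ν {y | t / 2 ≤ ‖u y‖} + ν {y | t / 2 ≤ ‖v y‖} := by
  refine (measure_mono_ae ?_).trans (measure_union_le _ _)
  filter_upwards [h] with y hy hty
  change t < ‖w y‖ at hty
  rw [hy] at hty
  rcases le_or_gt (t / 2) ‖u y‖ with hu | hu
  · exact Or.inl hu
  · refine Or.inr (?_ : t / 2 ≤ ‖v y‖)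
    linarith [norm_add_le (u y) (v y)]

variable {Sp : Lp E p μ →L[𝕜] Lp F p ν} {Sq : Lp E q μ →L[𝕜] Lp F q ν}
  {Sr : Lp E r μ →L[𝕜] Lp F r ν}

theorem Compatible.apply_ae_eq_add (hSq : Compatible Sp Sq) (hSr : Compatible Sp Sr) (f : Lp E p μ)
    {I : Set α} (hI : MeasurableSet I) (hq : MemLp (I.indicator f) q μ)
    (hr : MemLp (Iᶜ.indicator f) r μ) :
    Sp f =ᵐ[ν] fun y => Sq hq.toLp y + Sr hr.toLp y := by
  have hu := (Lp.memLp f).indicator hI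
  have hv := (Lp.memLp f).indicator hI.compl
  have hsum : f = hu.toLp + hv.toLp := by
    rw [← MemLp.toLp_add]
    exact ((MemLp.toLp_congr _ (Lp.memLp f) (.of_eq (Set.indicator_self_add_compl I f))).trans
      (Lp.toLp_coeFn f _)).symm
  conv_lhs => rw [hsum, map_add]
  exact (Lp.coeFn_add _ _).trans ((hSq _ _ (hu.coeFn_toLp.trans hq.coeFn_toLp.symm)).add
    (hSr _ _ (hv.coeFn_toLp.trans hr.coeFn_toLp.symm)))

theorem meas_norm_apply_gt_le_of_compatible [IsFiniteMeasure μ] (hqp : q ≤ p) (hq : q ≠ ∞)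
    (hr : r ≠ ∞) (hSq : Compatible Sp Sq) (hSr : Compatible Sp Sr) {A B : ℝ}
    (hA : ‖Sq‖ ≤ A) (hB : ‖Sr‖ ≤ B) (f : Lp E p μ) {s t : ℝ} (ht : 0 < t) :
    ν {y | t < ‖Sp f y‖} ≤
      ENNReal.ofReal ((2 * A / t) ^ q.toReal) *
        ∫⁻ x in {x | s < ‖f x‖}, ENNReal.ofReal (‖f x‖ ^ q.toReal) ∂μ +
      ENNReal.ofReal ((2 * B / t) ^ r.toReal) *
        ∫⁻ x in {x | ‖f x‖ ≤ s}, ENNReal.ofReal (‖f x‖ ^ r.toReal) ∂μ := by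
  have hlarge : MeasurableSet {x | s < ‖f x‖} :=
    measurableSet_lt measurable_const (Lp.stronglyMeasurable f).norm.measurable
  have hcompl : {x | ‖f x‖ ≤ s} = {x | s < ‖f x‖}ᶜ := by
    simp only [Set.compl_ofPred, not_lt]
  have hu : MemLp ({x | s < ‖f x‖}.indicator f) q μ :=
    ((Lp.memLp f).indicator hlarge).mono_exponent hqp
  have hv : MemLp ({x | s < ‖f x‖}ᶜ.indicator f) r μ := by
    refine MemLp.of_bound ((Lp.memLp f).indicator hlarge.compl).1 |s| (.of_forall fun x => ?_)
    rw [← hcompl, norm_indicator_eq_indicator_norm]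
    exact Set.indicator_apply_le' (fun hx => le_trans hx (le_abs_self s)) fun _ => abs_nonneg s
  have hhalf (D : ℝ) : D / (t / 2) = 2 * D / t := by field_simp
  rw [hcompl, ← lintegral_norm_toLp_indicator_rpow hq hlarge hu,
    ← lintegral_norm_toLp_indicator_rpow hr hlarge.compl hv, ← hhalf, ← hhalf]
  exact (meas_norm_gt_le_add_of_ae_eq_add (hSq.apply_ae_eq_add hSr f hlarge hu hv) t).trans
    (add_le_add (meas_norm_apply_ge_le hq Sq hA _ (half_pos ht))
      (meas_norm_apply_ge_le hr Sr hB _ (half_pos ht)))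

theorem norm_rpow_le_of_lintegral_le (hp : p ≠ ∞) (S : Lp E p μ →L[𝕜] Lp F p ν) {C κ : ℝ}
    (hC : 0 ≤ C) (hκ : 0 < κ)
    (h : ∀ f, ∫⁻ y, ENNReal.ofReal ((‖S f y‖ / κ) ^ p.toReal) ∂ν ≤
      ENNReal.ofReal C * ∫⁻ x, ENNReal.ofReal (‖f x‖ ^ p.toReal) ∂μ) :
    ‖S‖ ^ p.toReal ≤ C * κ ^ p.toReal := by
  have hp0 : 0 < p.toReal := ENNReal.toReal_pos (zero_lt_one.trans_le Fact.out).ne' hp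
  have hscale {y : ℝ} (hy : 0 ≤ y) : ENNReal.ofReal ((y / κ) ^ p.toReal) =
      ENNReal.ofReal (y ^ p.toReal) * ENNReal.ofReal (κ ^ p.toReal)⁻¹ := by
    rw [Real.div_rpow hy hκ.le, div_eq_mul_inv, ENNReal.ofReal_mul (Real.rpow_nonneg hy _)]
  have hstrong (f : Lp E p μ) : (‖S f‖ / κ) ^ p.toReal ≤ C * ‖f‖ ^ p.toReal := by
    have hf := h f
    simp only [hscale (norm_nonneg _)] at hf
    rwa [lintegral_mul_const' _ _ ENNReal.ofReal_ne_top, ← ofReal_norm_rpow_eq_lintegral hp,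
      ← ofReal_norm_rpow_eq_lintegral hp, ← hscale (norm_nonneg _), ← ENNReal.ofReal_mul hC,
      ENNReal.ofReal_le_ofReal_iff (by positivity)] at hf
  have hbound : ‖S‖ ≤ (C * κ ^ p.toReal) ^ p.toReal⁻¹ := by
    refine ContinuousLinearMap.opNorm_le_bound _ (by positivity) fun f => ?_
    rw [← Real.rpow_le_rpow_iff (norm_nonneg _) (by positivity) hp0,
      Real.mul_rpow (by positivity) (norm_nonneg _),
      Real.rpow_inv_rpow (by positivity) hp0.ne', mul_right_comm,
      ← div_le_iff₀ (by positivity), ← Real.div_rpow (norm_nonneg _) hκ.le]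
    exact hstrong f
  exact (Real.rpow_le_rpow (norm_nonneg _) hbound hp0.le).trans_eq
    (Real.rpow_inv_rpow (by positivity) hp0.ne')

theorem norm_rpow_le_of_compatible [IsFiniteMeasure μ] (hqp : q < p) (hpr : p < r) (hr : r ≠ ∞)
    (hSq : Compatible Sp Sq) (hSr : Compatible Sp Sr) {A B κ : ℝ}
    (hA : ‖Sq‖ ≤ A) (hB : ‖Sr‖ ≤ B) (hκ : 0 < κ) :
    ‖Sp‖ ^ p.toReal ≤ p.toReal * ((2 * A / κ) ^ q.toReal / (p.toReal - q.toReal) +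
      (2 * B / κ) ^ r.toReal / (r.toReal - p.toReal)) * κ ^ p.toReal := by
  have hp : p ≠ ∞ := (hpr.trans_le le_top).ne
  have hq : q ≠ ∞ := (hqp.trans_le le_top).ne
  have hq0 : 0 < q.toReal := ENNReal.toReal_pos (zero_lt_one.trans_le Fact.out).ne' hq
  have hqp' : q.toReal < p.toReal := (ENNReal.toReal_lt_toReal hq hp).2 hqp
  have hpr' : p.toReal < r.toReal := (ENNReal.toReal_lt_toReal hp hr).2 hpr
  have hA0 : 0 ≤ A := (norm_nonneg _).trans hA
  have hB0 : 0 ≤ B := (norm_nonneg _).trans hB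
  have hC : 0 ≤ p.toReal * ((2 * A / κ) ^ q.toReal / (p.toReal - q.toReal) +
      (2 * B / κ) ^ r.toReal / (r.toReal - p.toReal)) := by
    have := sub_pos.2 hqp'
    have := sub_pos.2 hpr'
    positivity
  have hscale {D t s : ℝ} (hD : 0 ≤ D) (ht : 0 < t) :
      (2 * D / (t * κ)) ^ s = (2 * D / κ) ^ s * t ^ (-s) := by
    rw [Real.rpow_neg ht.le, ← Real.inv_rpow ht.le, ← Real.mul_rpow (by positivity) (by positivity)]
    congr 1
    field_simp
  refine norm_rpow_le_of_lintegral_le hp Sp hC hκ fun f => ?_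
  refine lintegral_rpow_le_of_meas_lt_le
    ((Lp.aestronglyMeasurable (Sp f)).norm.aemeasurable.div_const κ) (fun _ => by positivity)
    (Lp.stronglyMeasurable f).norm.measurable (fun _ => norm_nonneg _) hq0 hqp' hpr'
    (by positivity) (by positivity) fun t ht => ?_
  simpa only [lt_div_iff₀ hκ, hscale hA0 ht, hscale hB0 ht] using
    meas_norm_apply_gt_le_of_compatible hqp.le hq hr hSq hSr hA hB f (s := t) (mul_pos ht hκ)

theorem exists_mul_rpow_eq_mul_rpow {p q r : ℝ} (hp : p ≠ 0) (hqr : q ≠ r) {A B : ℝ}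
    (hA : 0 < A) (hB : 0 < B) :
    ∃ κ > 0, A ^ q * κ ^ (p - q) =
        (A ^ (1 - r * (p - q) / (p * (r - q))) * B ^ (r * (p - q) / (p * (r - q)))) ^ p ∧
      B ^ r * κ ^ (p - r) =
        (A ^ (1 - r * (p - q) / (p * (r - q))) * B ^ (r * (p - q) / (p * (r - q)))) ^ p := by
  have hrq : r - q ≠ 0 := sub_ne_zero.2 hqr.symm
  obtain ⟨a, rfl⟩ : ∃ a, Real.exp a = A := ⟨Real.log A, Real.exp_log hA⟩
  obtain ⟨b, rfl⟩ : ∃ b, Real.exp b = B := ⟨Real.log B, Real.exp_log hB⟩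
  refine ⟨Real.exp ((r * b - q * a) / (r - q)), Real.exp_pos _, ?_, ?_⟩ <;>
  · simp only [← Real.exp_mul, ← Real.exp_add]
    congr 1
    field_simp
    ring

variable (μ ν 𝕜 E F) in
theorem exists_norm_le_of_compatible [IsFiniteMeasure μ] (hqp : q < p) (hpr : p < r)
    (hr : r ≠ ∞) :
    ∃ t ∈ Set.Ioo (0 : ℝ) 1, ∃ C : ℝ, ∀ (Sp : Lp E p μ →L[𝕜] Lp F p ν)
      (Sq : Lp E q μ →L[𝕜] Lp F q ν) (Sr : Lp E r μ →L[𝕜] Lp F r ν),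
      Compatible Sp Sq → Compatible Sp Sr → ∀ A B : ℝ, 0 < A → 0 < B → ‖Sq‖ ≤ A → ‖Sr‖ ≤ B →
        ‖Sp‖ ≤ C * (A ^ (1 - t) * B ^ t) := by
  have hp : p ≠ ∞ := (hpr.trans_le le_top).ne
  have hq : q ≠ ∞ := (hqp.trans_le le_top).ne
  have hq0 : 0 < q.toReal := ENNReal.toReal_pos (zero_lt_one.trans_le Fact.out).ne' hq
  have hqp' : 0 < p.toReal - q.toReal := sub_pos.2 ((ENNReal.toReal_lt_toReal hq hp).2 hqp)
  have hpr' : 0 < r.toReal - p.toReal := sub_pos.2 ((ENNReal.toReal_lt_toReal hp hr).2 hpr)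
  have hp0 : 0 < p.toReal := by linarith
  have hr0 : 0 < r.toReal := by linarith
  have hrq : 0 < r.toReal - q.toReal := by linarith
  set P := p.toReal
  set Q := q.toReal
  set R := r.toReal
  set C := P * (2 ^ Q / (P - Q) + 2 ^ R / (R - P)) with hC
  refine ⟨R * (P - Q) / (P * (R - Q)), ⟨by positivity, ?_⟩, C ^ P⁻¹, ?_⟩
  · rw [div_lt_one (by positivity)]
    nlinarith
  intro Sp Sq Sr hSq hSr A B hA0 hB0 hA hB
  obtain ⟨κ, hκ, hκA, hκB⟩ := exists_mul_rpow_eq_mul_rpow hp0.ne' (by linarith : Q ≠ R) hA0 hB0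
  set X := A ^ (1 - R * (P - Q) / (P * (R - Q))) * B ^ (R * (P - Q) / (P * (R - Q)))
  have hX : 0 < X := by positivity
  rw [← Real.rpow_le_rpow_iff (norm_nonneg _) (by positivity) hp0,
    Real.mul_rpow (by positivity) hX.le, Real.rpow_inv_rpow (by positivity) hp0.ne']
  refine (norm_rpow_le_of_compatible hqp hpr hr hSq hSr hA hB hκ).trans_eq ?_
  have hscale {D s : ℝ} (hD : 0 < D) : (2 * D / κ) ^ s * κ ^ P = 2 ^ s * (D ^ s * κ ^ (P - s)) := by
    rw [Real.div_rpow (by positivity) hκ.le, Real.mul_rpow zero_le_two hD.le, Real.rpow_sub hκ]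
    ring
  calc P * ((2 * A / κ) ^ Q / (P - Q) + (2 * B / κ) ^ R / (R - P)) * κ ^ P
      = P * ((2 * A / κ) ^ Q * κ ^ P / (P - Q) + (2 * B / κ) ^ R * κ ^ P / (R - P)) := by ring
    _ = C * X ^ P := by rw [hscale hA0, hscale hB0, hκA, hκB, hC]; ring

end Marcinkiewicz

/-! ### Countable compact sets have capacity zero -/

section Capacity

variable {X : Type*}

/-- The multiset of roots built from a sequence `x` by repeatedly doubling all multiplicities and
adjoining the next term. Each `x i` makes up a proportion of at least `2 ^ (-i - 1)` of all later
stages, so that a product over the roots that is small near `x i` remains small there. -/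
def doublingMultiset (x : ℕ → X) : ℕ → Multiset X
  | 0 => 0
  | N + 1 => x N ::ₘ (doublingMultiset x N + doublingMultiset x N)

variable {x : ℕ → X}

theorem card_doublingMultiset_add_one (x : ℕ → X) (N : ℕ) :
    (doublingMultiset x N).card + 1 = 2 ^ N := by
  induction N with
  | zero => simp [doublingMultiset]
  | succ N ih => rw [doublingMultiset, Multiset.card_cons, Multiset.card_add, pow_succ, ← ih]; ring

theorem mem_range_of_mem_doublingMultiset {N : ℕ} {y : X} (hy : y ∈ doublingMultiset x N) :
    y ∈ Set.range x := by
  induction N with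
  | zero => simp [doublingMultiset] at hy
  | succ N ih =>
    rw [doublingMultiset, Multiset.mem_cons, Multiset.mem_add, or_self] at hy
    exact hy.elim (fun h => ⟨N, h.symm⟩) ih

theorem prod_map_doublingMultiset_succ {M : Type*} [CommMonoid M] (f : X → M) (N : ℕ) :
    ((doublingMultiset x (N + 1)).map f).prod =
      f (x N) * ((doublingMultiset x N).map f).prod ^ 2 := by
  rw [doublingMultiset, Multiset.map_cons, Multiset.prod_cons, Multiset.map_add, Multiset.prod_add,
    sq]

theorem prod_map_doublingMultiset_lt_pow {f : X → ℝ} (hf0 : ∀ i, 0 ≤ f (x i))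
    (hf1 : ∀ i, f (x i) ≤ 1) {δ : ℝ} {M N : ℕ} (hMN : M ≤ N)
    (hM : ((doublingMultiset x M).map f).prod < δ ^ 2 ^ M) :
    ((doublingMultiset x N).map f).prod < δ ^ 2 ^ N := by
  induction N, hMN using Nat.le_induction with
  | base => exact hM
  | succ N _ ih =>
    have hprod : 0 ≤ ((doublingMultiset x N).map f).prod := Multiset.prod_map_nonneg fun y hy => by
      obtain ⟨i, rfl⟩ := mem_range_of_mem_doublingMultiset hy
      exact hf0 i
    rw [prod_map_doublingMultiset_succ, pow_succ 2 N, pow_mul]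
    exact (mul_le_of_le_one_left (sq_nonneg _) (hf1 N)).trans_lt
      (pow_lt_pow_left₀ ih hprod two_ne_zero)

theorem continuous_prod_map_doublingMultiset {Y : Type*} [TopologicalSpace Y] {f : Y → X → ℝ}
    (hf : ∀ i, Continuous fun y => f y (x i)) (N : ℕ) :
    Continuous fun y => ((doublingMultiset x N).map (f y)).prod := by
  induction N with
  | zero => simpa [doublingMultiset] using continuous_const
  | succ N ih =>
    simp only [prod_map_doublingMultiset_succ]
    exact (hf N).mul (ih.pow 2)

variable [PseudoMetricSpace X] {K : Set X}

theorem exists_prod_dist_div_doublingMultiset_lt (hK : IsCompact K) (hx : K = Set.range x) {D : ℝ}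
    (hD : ∀ y ∈ K, ∀ z ∈ K, dist y z ≤ D) {δ : ℝ} (hδ : 0 < δ) :
    ∃ N ≠ 0, ∀ z ∈ K, ((doublingMultiset x N).map fun y => dist z y / D).prod < δ ^ 2 ^ N := by
  have hxK (i : ℕ) : x i ∈ K := hx ▸ Set.mem_range_self i
  have hD0 : 0 ≤ D := dist_nonneg.trans (hD _ (hxK 0) _ (hxK 0))
  let V (N : ℕ) : Set X :=
    {z | ((doublingMultiset x (N + 1)).map fun y => dist z y / D).prod < δ ^ 2 ^ (N + 1)}
  have hV (N : ℕ) : IsOpen (V N) := isOpen_lt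
    (continuous_prod_map_doublingMultiset (by fun_prop) (N + 1)) continuous_const
  have hcover : K ⊆ ⋃ N, V N := by
    intro z hz
    obtain ⟨i, rfl⟩ : z ∈ Set.range x := hx ▸ hz
    refine Set.mem_iUnion.2 ⟨i, ?_⟩
    change ((doublingMultiset x (i + 1)).map fun y => dist (x i) y / D).prod < _
    rw [prod_map_doublingMultiset_succ, dist_self, zero_div, zero_mul]
    positivity
  obtain ⟨t, ht⟩ := hK.elim_finite_subcover V hV hcover
  refine ⟨t.sup id + 1, Nat.succ_ne_zero _, fun z hz => ?_⟩
  obtain ⟨i, hi, hzi⟩ := Set.mem_iUnion₂.1 (ht hz)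
  exact prod_map_doublingMultiset_lt_pow (f := fun y => dist z y / D) (fun j => by positivity)
    (fun j => div_le_one_of_le₀ (hD z hz _ (hxK j)) hD0)
    (Nat.succ_le_succ (Finset.le_sup (f := id) hi)) hzi

theorem exists_multiset_prod_dist_le_pow (hK : IsCompact K) (hc : K.Countable) (hne : K.Nonempty)
    {ε : ℝ} (hε : 0 < ε) :
    ∃ s : Multiset X, s ≠ 0 ∧ (∀ x ∈ s, x ∈ K) ∧
      ∀ z ∈ K, (s.map fun x => dist z x).prod ≤ ε ^ s.card := by
  obtain ⟨x, hx⟩ := hc.exists_eq_range hne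
  set D := Metric.diam K + 1
  have hD : 0 < D := by have := Metric.diam_nonneg (s := K); positivity
  have hdist (y) (hy : y ∈ K) (z) (hz : z ∈ K) : dist y z ≤ D :=
    (Metric.dist_le_diam_of_mem hK.isBounded hy hz).trans (by simp [D])
  set δ := min (ε / D) 1
  have hδ : 0 < δ := by positivity
  obtain ⟨N, hN0, hN⟩ := exists_prod_dist_div_doublingMultiset_lt hK hx hdist hδ
  have hcard := card_doublingMultiset_add_one x N
  refine ⟨doublingMultiset x N, ?_, fun y hy => hx ▸ mem_range_of_mem_doublingMultiset hy,
    fun z hz => ?_⟩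
  · rintro h0
    rw [h0, Multiset.card_zero, zero_add, eq_comm, Nat.pow_eq_one] at hcard
    simp [hN0] at hcard
  calc ((doublingMultiset x N).map fun y => dist z y).prod
      = D ^ (doublingMultiset x N).card *
          ((doublingMultiset x N).map fun y => dist z y / D).prod := by
        rw [← Multiset.prod_replicate, ← Multiset.map_const', ← Multiset.prod_map_mul]
        simp only [mul_div_cancel₀ _ hD.ne']
    _ ≤ D ^ (doublingMultiset x N).card * δ ^ (doublingMultiset x N).card := by
        gcongr
        exact (hN z hz).le.trans (pow_le_pow_of_le_one hδ.le (min_le_right _ _) (by omega))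
    _ ≤ ε ^ (doublingMultiset x N).card := by
        rw [← mul_pow]
        gcongr
        exact (le_div_iff₀' hD).1 (min_le_left _ _)

end Capacity

/-! ### Spectra of operators on the scale of `L^p` spaces -/

section FunctionalCalculus

open Polynomial

theorem norm_eval_multiset_prod_X_sub_C {𝕜 : Type*} [NormedField 𝕜] (s : Multiset 𝕜) (z : 𝕜) :
    ‖((s.map fun x => X - C x).prod).eval z‖ = (s.map fun x => dist z x).prod := by
  induction s using Multiset.induction_on with
  | empty => simp
  | cons x s ih => simp [ih, dist_eq_norm]

theorem le_of_forall_pow_le_mul_pow {x y C : ℝ} (hy : 0 < y) (h : ∀ m : ℕ, x ^ m ≤ C * y ^ m) :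
    x ≤ y := by
  by_contra! hxy
  obtain ⟨m, hm⟩ := pow_unbounded_of_one_lt C ((one_lt_div hy).2 hxy)
  rw [div_pow, lt_div_iff₀ (by positivity)] at hm
  exact (h m).not_gt hm

theorem nonpos_of_forall_le_mul_rpow {d C t : ℝ} (ht : 0 < t)
    (h : ∀ ε > 0, d ≤ C * ε ^ t) : d ≤ 0 := by
  have hlim := ((Real.continuousAt_rpow_const 0 t (Or.inr ht.le)).tendsto.const_mul
    C).mono_left (nhdsWithin_le_nhds (s := Set.Ioi 0))
  rw [Real.zero_rpow ht.ne', mul_zero] at hlim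
  exact ge_of_tendsto hlim (eventually_mem_nhdsWithin.mono h)

variable {𝕜 E : Type*} [NontriviallyNormedField 𝕜] [NormedAddCommGroup E] [NormedSpace 𝕜 E]

theorem aeval_apply_of_apply_eq_smul {T : E →L[𝕜] E} {c : 𝕜} {v : E} (h : T v = c • v)
    (g : 𝕜[X]) : aeval T g v = g.eval c • v := by
  have hpow (k : ℕ) : (T ^ k) v = c ^ k • v := by
    induction k with
    | zero => simp
    | succ k ih => rw [pow_succ', mul_apply_eq_comp, ih, map_smul, h, smul_smul,
        pow_succ]
  induction g using Polynomial.induction_on' with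
  | add g₁ g₂ h₁ h₂ => rw [map_add, add_apply, h₁, h₂, eval_add, add_smul]
  | monomial k a =>
    rw [aeval_monomial, ← Algebra.smul_def, smul_apply, hpow, eval_monomial,
      mul_smul]

theorem mem_spectrum_of_apply_eq_smul [CompleteSpace E] {T : E →L[𝕜] E} {c : 𝕜} {v : E}
    (h : T v = c • v) (hv : v ≠ 0) : c ∈ spectrum 𝕜 T := by
  rw [ContinuousLinearMap.spectrum_eq]
  exact (Module.End.hasEigenvalue_of_hasEigenvector
    (Module.End.hasEigenvector_iff.2 ⟨Module.End.mem_eigenspace_iff.2 h, hv⟩)).mem_spectrum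

theorem norm_eval_le_norm_aeval [CompleteSpace E] {T : E →L[𝕜] E} {z : 𝕜}
    (hz : z ∈ spectrum 𝕜 T) (g : 𝕜[X]) : ‖g.eval z‖ ≤ ‖aeval T g‖ :=
  (spectrum.norm_le_norm_mul_of_mem (spectrum.subset_polynomial_aeval T g ⟨z, hz, rfl⟩)).trans
    (mul_le_of_le_one_right (norm_nonneg _) ContinuousLinearMap.norm_id_le)

theorem norm_aeval_multiset_prod_X_sub_C_le (T : E →L[𝕜] E) {s : Multiset 𝕜} {R : ℝ}
    (hs : ∀ x ∈ s, ‖T‖ + ‖x‖ ≤ R) : ‖aeval T (s.map fun x => X - C x).prod‖ ≤ R ^ s.card := by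
  induction s using Multiset.induction_on with
  | empty =>
    rw [Multiset.map_zero, Multiset.prod_zero, map_one, Multiset.card_zero, pow_zero]
    exact ContinuousLinearMap.norm_id_le
  | cons x s ih =>
    have hx := hs x (Multiset.mem_cons_self x s)
    have hfactor : ‖aeval T (X - C x)‖ ≤ R := by
      rw [map_sub, aeval_X, aeval_C, Algebra.algebraMap_eq_smul_one]
      refine (norm_sub_le _ _).trans (le_trans ?_ hx)
      rw [norm_smul]
      gcongr
      exact mul_le_of_le_one_right (norm_nonneg _) ContinuousLinearMap.norm_id_le
    rw [Multiset.map_cons, Multiset.prod_cons, map_mul, Multiset.card_cons, pow_succ']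
    exact (norm_mul_le _ _).trans (mul_le_mul hfactor
      (ih fun y hy => hs y (Multiset.mem_cons_of_mem hy)) (norm_nonneg _)
      ((norm_nonneg _).trans hfactor))

end FunctionalCalculus

section Diagonal

variable {ι 𝕜 E : Type*} [RCLike 𝕜] [NormedAddCommGroup E] [InnerProductSpace 𝕜 E]
  (b : HilbertBasis ι 𝕜 E) {T : E →L[𝕜] E} {c : ι → 𝕜}

theorem hilbertBasis_repr_apply_of_diagonal (hT : ∀ i, T (b i) = c i • b i) (f : E) (i : ι) :
    b.repr (T f) i = c i * b.repr f i := by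
  classical
  have hexpand := (b.hasSum_repr f).mapL ((innerSL 𝕜 (b i)).comp T)
  have hterm (k : ι) : (innerSL 𝕜 (b i)).comp T (b.repr f k • b k) =
      if k = i then c i * b.repr f i else 0 := by
    rw [map_smul, ContinuousLinearMap.comp_apply, hT, map_smul, innerSL_apply_apply,
      orthonormal_iff_ite.1 b.orthonormal]
    rcases eq_or_ne k i with rfl | h
    · simp [mul_comm]
    · simp [h, h.symm]
  simp only [hterm] at hexpand
  rw [b.repr_apply_apply]
  exact hexpand.unique (hasSum_ite_eq i _)

theorem norm_le_of_hilbertBasis_diagonal (hT : ∀ i, T (b i) = c i • b i) {B : ℝ} (hB : 0 ≤ B)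
    (hc : ∀ i, ‖c i‖ ≤ B) : ‖T‖ ≤ B := by
  have hparseval (f : E) : HasSum (fun i => ‖b.repr f i‖ ^ 2) (‖f‖ ^ 2) := by
    rw [← b.repr.norm_map f]
    apply_mod_cast lp.hasSum_norm ?_ (b.repr f)
    simp
  refine ContinuousLinearMap.opNorm_le_bound _ hB fun f => ?_
  refine le_of_sq_le_sq ?_ (by positivity)
  rw [mul_pow]
  refine hasSum_le (fun i => ?_) (hparseval _) ((hparseval f).mul_left (B ^ 2))
  rw [hilbertBasis_repr_apply_of_diagonal b hT, norm_mul, mul_pow]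
  gcongr
  exact hc i

end Diagonal

section SpectralInclusion

open Polynomial

variable {α 𝕜 E : Type*} [MeasurableSpace α] {μ : Measure α} [NontriviallyNormedField 𝕜]
  [NormedAddCommGroup E] [NormedSpace 𝕜 E] {p q r : ℝ≥0∞}
  [Fact (1 ≤ p)] [Fact (1 ≤ q)] [Fact (1 ≤ r)]

theorem Compatible.aeval {S : Lp E p μ →L[𝕜] Lp E p μ} {T : Lp E q μ →L[𝕜] Lp E q μ}
    (h : Compatible S T) (g : 𝕜[X]) : Compatible (aeval S g) (aeval T g) := by
  intro f₁ f₂ hf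
  have hpow (k : ℕ) : (S ^ k) f₁ =ᵐ[μ] (T ^ k) f₂ := by
    induction k with
    | zero => exact hf
    | succ k ih => simpa only [pow_succ', mul_apply_eq_comp] using h _ _ ih
  induction g using Polynomial.induction_on' with
  | add g₁ g₂ h₁ h₂ =>
    simp only [map_add, add_apply]
    exact (Lp.coeFn_add _ _).trans ((h₁.add h₂).trans (Lp.coeFn_add _ _).symm)
  | monomial k a =>
    simp only [aeval_monomial, ← Algebra.smul_def, smul_apply]
    exact (Lp.coeFn_smul _ _).trans (((hpow k).const_smul a).trans (Lp.coeFn_smul _ _).symm)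

variable [CompleteSpace E] [IsFiniteMeasure μ]

variable (𝕜 E μ) in
-- Applying the interpolation inequality to all powers of `g` makes its constant equal to `1`.
theorem exists_norm_eval_le_of_compatible (hqp : q < p) (hpr : p < r) (hr : r ≠ ∞) :
    ∃ t ∈ Set.Ioo (0 : ℝ) 1, ∀ (Sp : Lp E p μ →L[𝕜] Lp E p μ) (Sq : Lp E q μ →L[𝕜] Lp E q μ)
      (Sr : Lp E r μ →L[𝕜] Lp E r μ), Compatible Sp Sq → Compatible Sp Sr →
      ∀ z ∈ spectrum 𝕜 Sp, ∀ (g : 𝕜[X]) (A B : ℝ), 0 < A → 0 < B →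
        ‖aeval Sq g‖ ≤ A → ‖aeval Sr g‖ ≤ B → ‖g.eval z‖ ≤ A ^ (1 - t) * B ^ t := by
  obtain ⟨t, ht, C, hC⟩ := exists_norm_le_of_compatible 𝕜 E E μ μ hqp hpr hr
  refine ⟨t, ht, fun Sp Sq Sr hSq hSr z hz g A B hA hB hgA hgB => ?_⟩
  refine le_of_forall_pow_le_mul_pow (C := C) (by positivity) fun m => ?_
  have hpow {e : ℝ≥0∞} [Fact (1 ≤ e)] {S : Lp E e μ →L[𝕜] Lp E e μ} {D : ℝ}
      (h : ‖Polynomial.aeval S g‖ ≤ D) : ‖Polynomial.aeval S (g ^ m)‖ ≤ D ^ m := by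
    rw [map_pow]
    refine le_trans ?_ (pow_le_pow_left₀ (norm_nonneg _) h m)
    rcases m.eq_zero_or_pos with rfl | hm
    · rw [pow_zero, pow_zero]; exact ContinuousLinearMap.norm_id_le
    · exact norm_pow_le' _ hm
  calc ‖g.eval z‖ ^ m = ‖(g ^ m).eval z‖ := by rw [eval_pow, norm_pow]
    _ ≤ ‖Polynomial.aeval Sp (g ^ m)‖ := norm_eval_le_norm_aeval hz _
    _ ≤ C * ((A ^ m) ^ (1 - t) * (B ^ m) ^ t) :=
      hC _ _ _ (hSq.aeval _) (hSr.aeval _) _ _ (by positivity) (by positivity) (hpow hgA) (hpow hgB)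
    _ = C * (A ^ (1 - t) * B ^ t) ^ m := by
      rw [mul_pow, Real.rpow_pow_comm hA.le, Real.rpow_pow_comm hB.le]

variable {T : ∀ (e : ℝ≥0∞) [Fact (1 ≤ e)], Lp E e μ →L[𝕜] Lp E e μ}

theorem exists_norm_eval_le_of_norm_aeval_two_le
    (hT : ∀ (e e' : ℝ≥0∞) [Fact (1 ≤ e)] [Fact (1 ≤ e')], Compatible (T e) (T e'))
    (hp : 1 < p) (hp' : p ≠ ∞) :
    ∃ t > (0 : ℝ), ∀ z ∈ spectrum 𝕜 (T p), ∀ (g : 𝕜[X]) (A B : ℝ), 0 < A → 0 < B →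
      (∀ (e : ℝ≥0∞) [Fact (1 ≤ e)], ‖aeval (T e) g‖ ≤ A) → ‖aeval (T 2) g‖ ≤ B →
        ‖g.eval z‖ ≤ A ^ (1 - t) * B ^ t := by
  rcases lt_trichotomy p 2 with h2 | rfl | h2
  · obtain ⟨t, ht, h⟩ := exists_norm_eval_le_of_compatible 𝕜 E μ hp h2 ENNReal.ofNat_ne_top
    exact ⟨t, ht.1, fun z hz g A B hA hB hgA hgB =>
      h (T p) (T 1) (T 2) (hT p 1) (hT p 2) z hz g A B hA hB (hgA 1) hgB⟩
  · refine ⟨1, one_pos, fun z hz g A B _ _ _ hgB => ?_⟩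
    rw [sub_self, Real.rpow_zero, one_mul, Real.rpow_one]
    exact (norm_eval_le_norm_aeval hz g).trans hgB
  · have : Fact (1 ≤ p + 1) := ⟨le_add_self⟩
    obtain ⟨t, ht, h⟩ := exists_norm_eval_le_of_compatible 𝕜 E μ h2
      (ENNReal.lt_add_right hp' one_ne_zero) (ENNReal.add_ne_top.2 ⟨hp', ENNReal.one_ne_top⟩)
    refine ⟨1 - t, sub_pos.2 ht.2, fun z hz g A B hA hB hgA hgB => ?_⟩
    rw [sub_sub_cancel, mul_comm]
    exact h (T p) (T 2) (T (p + 1)) (hT p 2) (hT p (p + 1)) z hz g B A hB hA hgB (hgA (p + 1))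

theorem spectrum_subset_of_forall_norm_aeval_two_le
    (hT : ∀ (e e' : ℝ≥0∞) [Fact (1 ≤ e)] [Fact (1 ≤ e')], Compatible (T e) (T e'))
    {R : ℝ} (hR : ∀ (e : ℝ≥0∞) [Fact (1 ≤ e)], ‖T e‖ ≤ R)
    {K : Set 𝕜} (hK : IsCompact K) (hc : K.Countable) (hne : K.Nonempty)
    (hK2 : ∀ (g : 𝕜[X]) (B : ℝ), (∀ z ∈ K, ‖g.eval z‖ ≤ B) → ‖aeval (T 2) g‖ ≤ B)
    (hp : 1 < p) (hp' : p ≠ ∞) : spectrum 𝕜 (T p) ⊆ K := by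
  obtain ⟨t, ht, hinterp⟩ := exists_norm_eval_le_of_norm_aeval_two_le hT hp hp'
  intro z hz
  by_contra hzK
  obtain ⟨d, hd, hdK⟩ : ∃ d > 0, ∀ x ∈ K, d ≤ dist z x :=
    ⟨Metric.infDist z K, (hK.isClosed.notMem_iff_infDist_pos hne).1 hzK,
      fun x hx => Metric.infDist_le_dist_of_mem hx⟩
  obtain ⟨S, hS⟩ := hK.isBounded.exists_norm_le
  set A := |R| + |S| + 1
  have hA : 0 < A := by positivity
  have hsmall {ε : ℝ} (hε : 0 < ε) : d ≤ A ^ (1 - t) * ε ^ t := by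
    obtain ⟨s, hs0, hsK, hs⟩ := exists_multiset_prod_dist_le_pow hK hc hne hε
    set g : 𝕜[X] := (s.map fun x => X - C x).prod
    have hg (w : 𝕜) : ‖g.eval w‖ = (s.map fun x => dist w x).prod :=
      norm_eval_multiset_prod_X_sub_C s w
    have hgA (e : ℝ≥0∞) [Fact (1 ≤ e)] : ‖aeval (T e) g‖ ≤ A ^ s.card :=
      norm_aeval_multiset_prod_X_sub_C_le _ fun x hx => by
        linarith [hR e, hS x (hsK x hx), le_abs_self R, le_abs_self S]
    have hlower : d ^ s.card ≤ ‖g.eval z‖ := by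
      rw [hg, ← Multiset.prod_replicate, ← Multiset.map_const']
      exact Multiset.prod_map_le_prod_map₀ _ _ (fun _ _ => hd.le) fun x hx => hdK x (hsK x hx)
    have hupper := hinterp z hz g (A ^ s.card) (ε ^ s.card) (by positivity) (by positivity) hgA
      (hK2 g _ fun w hw => (hg w).trans_le (hs w hw))
    rw [← Real.rpow_pow_comm hA.le, ← Real.rpow_pow_comm hε.le, ← mul_pow] at hupper
    exact (pow_le_pow_iff_left₀ hd.le (by positivity) (by simpa using hs0)).1
      (hlower.trans hupper)
  exact hd.not_ge (nonpos_of_forall_le_mul_rpow ht fun ε hε => hsmall hε)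

end SpectralInclusion

section Convolution

open Polynomial

variable (ν : Measure UnitAddCircle)

theorem conv_fourier (n : ℤ) (x : UnitAddCircle) :
    conv ν (fourier n) x = measureFourierCoeff ν n * fourier n x := by
  unfold conv measureFourierCoeff
  rw [← integral_mul_const]
  congr 1; funext y
  simp only [fourier_apply, sub_eq_add_neg, smul_add, smul_neg, toCircle_add, toCircle_neg,
    neg_smul, Circle.coe_mul]
  ring

variable [IsProbabilityMeasure ν]

theorem norm_measureFourierCoeff_le_one (n : ℤ) : ‖measureFourierCoeff ν n‖ ≤ 1 := by
  unfold measureFourierCoeff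
  refine (norm_integral_le_of_norm_le_const (C := 1) (Eventually.of_forall fun x => ?_)).trans
    (by simp)
  rw [fourier_apply, Circle.norm_coe]

theorem isCompact_closure_range_measureFourierCoeff :
    IsCompact (closure (Set.range (measureFourierCoeff ν))) :=
  (isCompact_closedBall (0 : ℂ) 1).closure_of_subset
    (Set.range_subset_iff.2 fun n => by simpa using norm_measureFourierCoeff_le_one ν n)

theorem convOp_fourierLp (p : ℝ≥0∞) [Fact (1 ≤ p)] (n : ℤ) :
    convOp ν p (fourierLp p n) = measureFourierCoeff ν n • fourierLp p n := by
  refine Lp.ext ?_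
  refine (coeFn_convOp ν p _).trans ((conv_congr (coeFn_fourierLp p n)).trans ?_)
  filter_upwards [Lp.coeFn_smul (measureFourierCoeff ν n) (fourierLp (T := 1) p n),
    coeFn_fourierLp (T := 1) p n] with x h1 h2
  rw [h1, Pi.smul_apply, h2, conv_fourier, smul_eq_mul]

theorem fourierLp_ne_zero (p : ℝ≥0∞) [Fact (1 ≤ p)] (n : ℤ) : fourierLp (T := 1) p n ≠ 0 := by
  intro hzero
  have hae : (fourier n : UnitAddCircle → ℂ) =ᵐ[haarAddCircle] 0 :=
    (coeFn_fourierLp p n).symm.trans (by rw [hzero]; exact Lp.coeFn_zero _ _ _)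
  obtain ⟨x, hx⟩ := hae.exists
  simp [fourier_apply] at hx

theorem norm_convOp_le_one (p : ℝ≥0∞) [Fact (1 ≤ p)] : ‖convOp ν p‖ ≤ 1 :=
  LinearMap.mkContinuous_norm_le _ zero_le_one _

theorem compatible_convOp (p q : ℝ≥0∞) [Fact (1 ≤ p)] [Fact (1 ≤ q)] :
    Compatible (convOp ν p) (convOp ν q) := fun f g h =>
  (coeFn_convOp ν p f).trans ((conv_congr h).trans (coeFn_convOp ν q g).symm)

theorem closure_range_subset_spectrum (p : ℝ≥0∞) [Fact (1 ≤ p)] :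
    closure (Set.range (measureFourierCoeff ν)) ⊆ spectrum ℂ (convOp ν p) :=
  closure_minimal (Set.range_subset_iff.2 fun n =>
    mem_spectrum_of_apply_eq_smul (convOp_fourierLp ν p n) (fourierLp_ne_zero p n))
    (spectrum.isClosed _)

theorem norm_aeval_convOp_two_le (g : ℂ[X]) {B : ℝ}
    (hB : ∀ n, ‖g.eval (measureFourierCoeff ν n)‖ ≤ B) : ‖aeval (convOp ν 2) g‖ ≤ B :=
  norm_le_of_hilbertBasis_diagonal (fourierBasis (T := 1))
    (fun n => by
      rw [coe_fourierBasis]; exact aeval_apply_of_apply_eq_smul (convOp_fourierLp ν 2 n) g)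
    ((norm_nonneg _).trans (hB 0)) hB

theorem spectrum_convOp_eq_closure_range
    (hc : (closure (Set.range (measureFourierCoeff ν))).Countable) {p : ℝ≥0∞} [Fact (1 ≤ p)]
    (hp : 1 < p) (hp' : p ≠ ∞) :
    spectrum ℂ (convOp ν p) = closure (Set.range (measureFourierCoeff ν)) := by
  refine Set.Subset.antisymm ?_ (closure_range_subset_spectrum ν p)
  exact spectrum_subset_of_forall_norm_aeval_two_le (T := fun e _ => convOp ν e)
    (fun e e' _ _ => compatible_convOp ν e e') (fun e _ => norm_convOp_le_one ν e)
    (isCompact_closure_range_measureFourierCoeff ν) hc ⟨_, subset_closure ⟨0, rfl⟩⟩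
    (fun g B hB => norm_aeval_convOp_two_le ν g fun n => hB _ (subset_closure ⟨n, rfl⟩)) hp hp'

end Convolution

/-! ### Cosine products -/

section CosProd

open scoped translate

variable {ι α : Type*} {l : Filter α}

theorem abs_prod_sub_prod_le {a b : ι → ℝ} (ha : ∀ i, |a i| ≤ 1) (hb : ∀ i, |b i| ≤ 1)
    (s : Finset ι) : |∏ i ∈ s, a i - ∏ i ∈ s, b i| ≤ ∑ i ∈ s, |a i - b i| := by
  classical
  induction s using Finset.induction_on with
  | empty => simp
  | insert i s hi ih =>
    rw [Finset.prod_insert hi, Finset.prod_insert hi, Finset.sum_insert hi]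
    have hs : |∏ i ∈ s, a i| ≤ 1 := by
      rw [Finset.abs_prod]
      exact Finset.prod_le_one (fun _ _ => abs_nonneg _) fun j _ => ha j
    calc |a i * ∏ i ∈ s, a i - b i * ∏ i ∈ s, b i|
        = |(a i - b i) * ∏ i ∈ s, a i + b i * (∏ i ∈ s, a i - ∏ i ∈ s, b i)| := by ring_nf
      _ ≤ |a i - b i| * |∏ i ∈ s, a i| + |b i| * |∏ i ∈ s, a i - ∏ i ∈ s, b i| := by
          rw [← abs_mul, ← abs_mul]; exact abs_add_le _ _
      _ ≤ |a i - b i| * 1 + 1 * ∑ i ∈ s, |a i - b i| := by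
          gcongr; exact hb i
      _ = _ := by rw [mul_one, one_mul]

theorem abs_tprod_sub_tprod_le {a b c : ι → ℝ} (ha : ∀ i, |a i| ≤ 1) (hb : ∀ i, |b i| ≤ 1)
    (hma : Multipliable a) (hmb : Multipliable b) (hc : Summable c)
    (h : ∀ i, |a i - b i| ≤ c i) : |∏' i, a i - ∏' i, b i| ≤ ∑' i, c i :=
  le_of_tendsto_of_tendsto' (hma.hasProd.sub hmb.hasProd).abs hc.hasSum fun s =>
    (abs_prod_sub_prod_le ha hb s).trans (Finset.sum_le_sum fun i _ => h i)

/-- The product `∏ₖ cos (π uₖ)` attached to a family of frequencies, which converges when the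
family is summable. A half turn in a frequency changes only the sign of a factor. -/
def cosProd (u : ι → ℝ) : ℝ := ∏' k, Real.cos (Real.pi * u k)

theorem cosProd_add_two_mul_intCast (u : ι → ℝ) (N : ι → ℤ) :
    cosProd (fun k => u k + 2 * N k) = cosProd u := by
  refine tprod_congr fun k => ?_
  rw [← Real.cos_add_int_mul_two_pi (Real.pi * u k) (N k)]
  ring_nf

theorem cosProd_translate {A : Type*} [AddCommGroup A] (a : A) (u : A → ℝ) :
    cosProd (τ a u) = cosProd u :=
  (Equiv.subRight a).tprod_eq fun k => Real.cos (Real.pi * u k)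

theorem summable_translate {A : Type*} [AddCommGroup A] {u : A → ℝ} (hu : Summable u) (a : A) :
    Summable (τ a u) :=
  (Equiv.subRight a).summable_iff.2 hu

theorem summable_norm_cos_sub_one {u : ι → ℝ} (hu : Summable u) :
    Summable fun k => ‖Real.cos (Real.pi * u k) - 1‖ := by
  refine (hu.abs.mul_left Real.pi).of_nonneg_of_le (fun _ => norm_nonneg _) fun k => ?_
  have := Real.abs_cos_sub_cos_le (Real.pi * u k) 0
  rwa [Real.cos_zero, sub_zero, abs_mul, abs_of_pos Real.pi_pos] at this

theorem multipliable_cos {u : ι → ℝ} (hu : Summable u) :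
    Multipliable fun k => Real.cos (Real.pi * u k) := by
  simpa using multipliable_one_add_of_summable (summable_norm_cos_sub_one hu)

theorem cosProd_ne_zero {u : ι → ℝ} (hu : Summable u)
    (h0 : ∀ k, Real.cos (Real.pi * u k) ≠ 0) : cosProd u ≠ 0 := by
  have := tprod_one_add_ne_zero_of_summable (f := fun k => Real.cos (Real.pi * u k) - 1)
    (by simpa using h0) (summable_norm_cos_sub_one hu)
  simpa [cosProd] using this

theorem abs_cosProd_le_prod {u : ι → ℝ} (hu : Summable u) (s : Finset ι) :
    |cosProd u| ≤ ∏ k ∈ s, |Real.cos (Real.pi * u k)| := by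
  classical
  refine le_of_tendsto (multipliable_cos hu).hasProd.abs ?_
  filter_upwards [eventually_ge_atTop s] with t ht
  exact Finset.prod_le_prod_of_subset_of_le_one ht (fun _ _ => abs_nonneg _)
    fun _ _ _ => Real.abs_cos_le_one _

theorem abs_cosProd_eq_of_add_intCast {u v : ι → ℝ} (hu : Summable u) (hv : Summable v)
    (N : ι → ℤ) (h : ∀ k, u k = v k + N k) : |cosProd u| = |cosProd v| := by
  rw [← Real.norm_eq_abs, ← Real.norm_eq_abs, cosProd, cosProd,
    (multipliable_cos hu).norm_tprod, (multipliable_cos hv).norm_tprod]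
  refine tprod_congr fun k => ?_
  rw [h, mul_add, mul_comm Real.pi (N k : ℝ), Real.cos_add_int_mul_pi, norm_mul, norm_zpow,
    norm_neg, norm_one, one_zpow, one_mul]

theorem abs_cosProd_sub_le {u v : ι → ℝ} (hu : Summable u) (hv : Summable v) :
    |cosProd u - cosProd v| ≤ Real.pi * ∑' k, |u k - v k| := by
  rw [← tsum_mul_left]
  refine abs_tprod_sub_tprod_le (fun _ => Real.abs_cos_le_one _) (fun _ => Real.abs_cos_le_one _)
    (multipliable_cos hu) (multipliable_cos hv) ((hu.sub hv).abs.mul_left Real.pi) fun k => ?_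
  refine (Real.abs_cos_sub_cos_le _ _).trans_eq ?_
  rw [← mul_sub, abs_mul, abs_of_pos Real.pi_pos]

theorem abs_cos_add_sub_cos_mul_cos_le (x y : ℝ) :
    |Real.cos (x + y) - Real.cos x * Real.cos y| ≤ |x| * |y| := by
  rw [Real.cos_add, sub_sub_cancel_left, abs_neg, abs_mul]
  exact mul_le_mul Real.abs_sin_le_abs Real.abs_sin_le_abs (abs_nonneg _) (abs_nonneg _)

theorem abs_cosProd_add_sub_mul_le {u v : ι → ℝ} (hu : Summable u) (hv : Summable v) :
    |cosProd (u + v) - cosProd u * cosProd v| ≤ Real.pi ^ 2 * ∑' k, |u k| * |v k| := by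
  have hs : Summable fun k => |u k| * |v k| :=
    (hu.abs.mul_right (∑' j, |v j|)).of_nonneg_of_le (fun _ => by positivity) fun k =>
      mul_le_mul_of_nonneg_left (hv.abs.le_tsum k fun _ _ => abs_nonneg _) (abs_nonneg _)
  rw [← tsum_mul_left, cosProd, cosProd, cosProd,
    ← (multipliable_cos hu).tprod_mul (multipliable_cos hv)]
  refine abs_tprod_sub_tprod_le (fun _ => Real.abs_cos_le_one _) (fun k => ?_)
    (multipliable_cos (hu.add hv)) ((multipliable_cos hu).mul (multipliable_cos hv))
    (hs.mul_left _) fun k => ?_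
  · rw [abs_mul]
    exact mul_le_one₀ (Real.abs_cos_le_one _) (abs_nonneg _) (Real.abs_cos_le_one _)
  · rw [Pi.add_apply, mul_add]
    refine (abs_cos_add_sub_cos_mul_cos_le _ _).trans_eq ?_
    rw [abs_mul, abs_mul, abs_of_pos Real.pi_pos]
    ring

theorem tendsto_cosProd_sub {u v : α → ι → ℝ} (hu : ∀ n, Summable (u n))
    (hv : ∀ n, Summable (v n)) (h : Tendsto (fun n => ∑' k, |u n k - v n k|) l (𝓝 0)) :
    Tendsto (fun n => cosProd (u n) - cosProd (v n)) l (𝓝 0) := by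
  refine squeeze_zero_norm (fun n => abs_cosProd_sub_le (hu n) (hv n)) ?_
  simpa using h.const_mul Real.pi

theorem tendsto_cosProd_add_sub_mul {u : ι → ℝ} {v : α → ι → ℝ} (hu : Summable u)
    (hv : ∀ n, Summable (v n)) {M : ℝ} (hM : ∀ n k, |v n k| ≤ M)
    (h0 : ∀ k, Tendsto (fun n => v n k) l (𝓝 0)) :
    Tendsto (fun n => cosProd (u + v n) - cosProd u * cosProd (v n)) l (𝓝 0) := by
  have h1 : Tendsto (fun n => ∑' k, |u k| * |v n k|) l (𝓝 (∑' _ : ι, 0)) := by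
    refine tendsto_tsum_of_dominated_convergence (hu.abs.mul_right M) (fun k => ?_)
      (Eventually.of_forall fun n k => ?_)
    · simpa using (h0 k).abs.const_mul |u k|
    · rw [norm_mul, norm_abs_eq_norm, norm_abs_eq_norm]
      exact mul_le_mul_of_nonneg_left (hM n k) (abs_nonneg _)
  rw [tsum_zero] at h1
  refine squeeze_zero_norm (fun n => abs_cosProd_add_sub_mul_le hu (hv n)) ?_
  simpa using h1.const_mul (Real.pi ^ 2)

end CosProd

section HalfLine

open scoped translate

/-- The sequence `θ⁻ᵏ` for `k ≥ 0`, extended by `0` to the negative integers, so that the `n`-th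
Fourier coefficient of the Bernoulli convolution is the cosine product of `2n` times it. -/
def halfGeom (θ : ℝ) : ℤ → ℝ := (Set.Ici 0).indicator fun k => θ ^ (-k)

theorem halfGeom_of_nonneg (θ : ℝ) {k : ℤ} (hk : 0 ≤ k) : halfGeom θ k = θ ^ (-k) :=
  Set.indicator_of_mem (Set.mem_Ici.2 hk) _

theorem halfGeom_of_notMem_range (θ : ℝ) {k : ℤ} (hk : k ∉ Set.range ((↑) : ℕ → ℤ)) :
    halfGeom θ k = 0 :=
  Set.indicator_of_notMem (s := Set.Ici 0) (fun h => hk ⟨k.toNat, Int.toNat_of_nonneg h⟩) _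

theorem halfGeom_natCast (θ : ℝ) (k : ℕ) : halfGeom θ k = θ⁻¹ ^ k := by
  rw [halfGeom_of_nonneg θ (Int.natCast_nonneg k), zpow_neg, zpow_natCast, inv_pow]

variable {θ : ℝ} {α : Type*} {l : Filter α}

theorem summable_halfGeom (hθ : 1 < θ) : Summable (halfGeom θ) := by
  rw [← Nat.cast_injective.summable_iff fun k => halfGeom_of_notMem_range θ]
  simpa only [Function.comp_def, halfGeom_natCast] using
    summable_geometric_of_lt_one (by positivity) (inv_lt_one_of_one_lt₀ hθ)

theorem measureFourierCoeff_eq_cosProd (hθ : 1 < θ) (n : ℤ) :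
    measureFourierCoeff (circleBernoulli θ) n = (cosProd ((2 * n : ℝ) • halfGeom θ) : ℂ) := by
  have hout : ∀ k ∉ Set.range ((↑) : ℕ → ℤ),
      Real.cos (Real.pi * ((2 * n : ℝ) • halfGeom θ) k) = 1 := fun k hk => by
    rw [Pi.smul_apply, halfGeom_of_notMem_range θ hk, smul_zero, mul_zero, Real.cos_zero]
  have hprod : HasProd (fun k : ℕ => Real.cos (Real.pi * ((2 * n : ℝ) • halfGeom θ) k))
      (cosProd ((2 * n : ℝ) • halfGeom θ)) :=
    (Nat.cast_injective.hasProd_iff hout).2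
      (multipliable_cos ((summable_halfGeom hθ).const_smul (2 * n : ℝ))).hasProd
  refine tendsto_nhds_unique (tendsto_prod_cos hθ n)
    (((Complex.continuous_ofReal.tendsto _).comp hprod.tendsto_prod_nat).congr fun N => ?_)
  rw [Function.comp_apply, Complex.ofReal_prod]
  refine Finset.prod_congr rfl fun k _ => ?_
  rw [Pi.smul_apply, halfGeom_natCast, smul_eq_mul]
  ring_nf

theorem tendsto_tsum_abs_indicator_Iio {g : ℤ → ℝ} (hg : Summable g) {a : α → ℤ}
    (ha : Tendsto a l atBot) :
    Tendsto (fun n => ∑' k, |(Set.Iio (a n)).indicator g k|) l (𝓝 0) := by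
  have h : Tendsto (fun n => ∑' k, |(Set.Iio (a n)).indicator g k|) l (𝓝 (∑' _ : ℤ, 0)) := by
    refine tendsto_tsum_of_dominated_convergence hg.abs (fun k => ?_)
      (Eventually.of_forall fun n k => ?_)
    · refine tendsto_const_nhds.congr' ?_
      filter_upwards [ha.eventually_le_atBot k] with n hn
      rw [Set.indicator_of_notMem (Set.notMem_Iio.2 hn), abs_zero]
    · rw [norm_abs_eq_norm]
      exact norm_indicator_le_norm_self _ _
  rwa [tsum_zero] at h

theorem tsum_abs_indicator_translate_sub (g : ℤ → ℝ) (j : ℤ) :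
    ∑' k, |(Set.Ici 0).indicator (τ j g) k - τ j g k| = ∑' k, |(Set.Iio (-j)).indicator g k| := by
  rw [← (Equiv.subRight j).tsum_eq fun k => |(Set.Iio (-j)).indicator g k|]
  refine tsum_congr fun k => ?_
  by_cases hk : 0 ≤ k <;> simp [Set.indicator, hk, not_lt.2, not_le.1]

theorem tendsto_tsum_abs_indicator_translate_add_smul_sub {g r : ℤ → ℝ} (hg : Summable g)
    (hr : Summable r) {j : α → ℤ} (hj : Tendsto j l atTop) {c : α → ℝ} (hc : Tendsto c l (𝓝 0)) :
    Tendsto (fun n => ∑' k, |((Set.Ici 0).indicator (τ (j n) g) + c n • r - τ (j n) g) k|)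
      l (𝓝 0) := by
  have hlim : Tendsto (fun n => ∑' k, |(Set.Ici 0).indicator (τ (j n) g) k - τ (j n) g k| +
      |c n| * ∑' k, |r k|) l (𝓝 0) := by
    simp only [tsum_abs_indicator_translate_sub]
    simpa using (tendsto_tsum_abs_indicator_Iio hg (tendsto_neg_atTop_atBot.comp hj)).add
      (hc.abs.mul_const (∑' k, |r k|))
  refine squeeze_zero (fun n => tsum_nonneg fun k => abs_nonneg _) (fun n => ?_) hlim
  have hτ := summable_translate hg (j n)
  have h1 := ((hτ.indicator (Set.Ici 0)).sub hτ).abs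
  have h2 : Summable fun k => |c n| * |r k| := hr.abs.mul_left _
  rw [← tsum_mul_left, ← h1.tsum_add h2]
  refine Summable.tsum_le_tsum (fun k => ?_)
    (((hτ.indicator _).add (hr.const_smul (c n))).sub hτ).abs (h1.add h2)
  rw [← abs_mul, Pi.sub_apply, Pi.add_apply, add_sub_right_comm]
  exact abs_add_le _ _

end HalfLine

/-! ### Conjugates of a Pisot number -/

section Conjugates

open IntermediateField

variable {θ : ℝ}

theorem exists_embedding_norm_lt_one (hθ : IsPisot θ) : ∃ σ₀ : ℚ⟮θ⟯ →ₐ[ℚ] ℂ,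
    σ₀ (AdjoinSimple.gen ℚ θ) = θ ∧
      ∀ σ : ℚ⟮θ⟯ →ₐ[ℚ] ℂ, σ ≠ σ₀ → ‖σ (AdjoinSimple.gen ℚ θ)‖ < 1 := by
  have hθQ : IsIntegral ℚ θ := hθ.2.1.tower_top
  let σ₀ : ℚ⟮θ⟯ →ₐ[ℚ] ℂ := (Complex.ofRealAm.restrictScalars ℚ).comp (IntermediateField.val _)
  have hσ₀ : σ₀ (AdjoinSimple.gen ℚ θ) = θ := rfl
  refine ⟨σ₀, hσ₀, fun σ hσ => hθ.2.2 _ ?_ fun h => hσ ?_⟩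
  · rw [Polynomial.mem_aroots]
    refine ⟨minpoly.ne_zero hθQ, ?_⟩
    rw [← minpoly_gen ℚ θ, Polynomial.aeval_algHom_apply]
    exact (congrArg σ (minpoly.aeval ℚ (AdjoinSimple.gen ℚ θ))).trans (map_zero σ)
  · exact (adjoin.powerBasis hθQ).algHom_ext (h.trans hσ₀.symm)

theorem exists_embedding_ne (hint : IsIntegral ℚ θ) (hirr : Irrational θ) (σ₀ : ℚ⟮θ⟯ →ₐ[ℚ] ℂ) :
    ∃ σ, σ ≠ σ₀ := by
  have : FiniteDimensional ℚ ℚ⟮θ⟯ := adjoin.finiteDimensional hint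
  by_contra! hall
  have hcard : Fintype.card (ℚ⟮θ⟯ →ₐ[ℚ] ℂ) ≤ 1 :=
    Fintype.card_le_one_iff.2 fun a b => (hall a).trans (hall b).symm
  rw [AlgHom.card, adjoin.finrank hint] at hcard
  obtain ⟨q, hq⟩ := minpoly.natDegree_eq_one_iff.1 (hcard.antisymm (minpoly.natDegree_pos hint))
  exact hirr ⟨q, hq⟩

theorem irrational_pow (hθ : IsPisot θ) (hirr : Irrational θ) {k : ℕ} (hk : k ≠ 0) :
    Irrational (θ ^ k) := by
  obtain ⟨σ₀, hσ₀, hσ⟩ := exists_embedding_norm_lt_one hθ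
  obtain ⟨σ, hne⟩ := exists_embedding_ne hθ.2.1.tower_top hirr σ₀
  rintro ⟨q, hq⟩
  have hgen : AdjoinSimple.gen ℚ θ ^ k = algebraMap ℚ ℚ⟮θ⟯ q := by
    apply (algebraMap ℚ⟮θ⟯ ℝ).injective
    rw [map_pow, AdjoinSimple.algebraMap_gen, ← hq, ← IsScalarTower.algebraMap_apply]
    rfl
  have hconj : σ (AdjoinSimple.gen ℚ θ) ^ k = (θ : ℂ) ^ k := by
    rw [← hσ₀, ← map_pow, ← map_pow, hgen, AlgHom.commutes, AlgHom.commutes]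
  have hnorm := congrArg norm hconj
  rw [norm_pow, norm_pow, Complex.norm_real,
    Real.norm_of_nonneg (zero_le_one.trans hθ.1.le)] at hnorm
  exact ((pow_lt_one₀ (norm_nonneg _) (hσ σ hne) hk).trans (one_lt_pow₀ hθ.1 hk)).ne hnorm

theorem irrational_zpow (hθ : IsPisot θ) (hirr : Irrational θ) {k : ℤ} (hk : k ≠ 0) :
    Irrational (θ ^ k) := by
  have h := irrational_pow hθ hirr (Int.natAbs_ne_zero.2 hk)
  rcases k.natAbs_eq with hk' | hk' <;> rw [hk']
  · rwa [zpow_natCast]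
  · rw [zpow_neg, zpow_natCast]
    exact h.inv

theorem exists_intCast_summable_sub_pow (hθ : IsPisot θ) :
    ∃ T : ℕ → ℤ, Summable fun j => (T j : ℝ) - θ ^ j := by
  classical
  have hθQ : IsIntegral ℚ θ := hθ.2.1.tower_top
  obtain ⟨σ₀, hσ₀, hσ⟩ := exists_embedding_norm_lt_one hθ
  have : FiniteDimensional ℚ ℚ⟮θ⟯ := adjoin.finiteDimensional hθQ
  have hgen : IsIntegral ℤ (AdjoinSimple.gen ℚ θ) := by
    rw [← isIntegral_algebraMap_iff (algebraMap ℚ⟮θ⟯ ℝ).injective, AdjoinSimple.algebraMap_gen]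
    exact hθ.2.1
  -- The integer near `θ ^ j` is the trace of `θ ^ j`: the other conjugates contribute geometrically
  -- decaying terms.
  have htrace : ∀ j : ℕ, ∃ t : ℤ, algebraMap ℤ ℚ t =
      Algebra.trace ℚ ℚ⟮θ⟯ (AdjoinSimple.gen ℚ θ ^ j) := fun j =>
    IsIntegrallyClosed.isIntegral_iff.1 (Algebra.isIntegral_trace (hgen.pow j))
  choose T hT using htrace
  have hsum : ∀ j, (((T j : ℝ) - θ ^ j : ℝ) : ℂ) =
      ∑ σ ∈ Finset.univ.erase σ₀, σ (AdjoinSimple.gen ℚ θ) ^ j := by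
    intro j
    have h1 := trace_eq_sum_embeddings (K := ℚ) (L := ℚ⟮θ⟯) ℂ (x := AdjoinSimple.gen ℚ θ ^ j)
    rw [← hT j, ← Finset.add_sum_erase _ _ (Finset.mem_univ σ₀)] at h1
    simp only [map_pow, hσ₀] at h1
    push_cast
    rw [sub_eq_iff_eq_add', ← h1]
    simp
  refine ⟨T, ?_⟩
  rw [← Complex.summable_ofReal]
  simp only [hsum]
  exact summable_sum fun σ hs =>
    summable_geometric_of_norm_lt_one (hσ σ (Finset.ne_of_mem_erase hs))

theorem exists_intCast_summable_zpow_neg_sub (hθ : IsPisot θ) :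
    ∃ N : ℤ → ℤ, Summable fun k : ℤ => θ ^ (-k) - N k := by
  obtain ⟨T, hT⟩ := exists_intCast_summable_sub_pow hθ
  refine ⟨fun k => if 0 < k then 0 else T k.natAbs, .of_nat_of_neg ?_ ?_⟩
  · rw [← summable_nat_add_iff 1]
    refine ((summable_geometric_of_lt_one (inv_nonneg.2 (zero_le_one.trans hθ.1.le))
      (inv_lt_one_of_one_lt₀ hθ.1)).comp_injective (add_left_injective 1)).congr fun k => ?_
    beta_reduce
    rw [if_pos (by positivity), Int.cast_zero, sub_zero, zpow_neg, zpow_natCast, ← inv_pow,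
      Function.comp_apply]
  · refine hT.neg.congr fun k => ?_
    beta_reduce
    rw [if_neg (by simp), neg_neg, zpow_natCast, Int.natAbs_neg, Int.natAbs_natCast, neg_sub]

end Conjugates

/-! ### Limit points -/

section LimitPoints

variable {a : ℤ → ℂ} {z : ℂ}

theorem mem_limitPoints_iff : z ∈ limitPoints a ↔ MapClusterPt z cofinite a := by
  simp only [mapClusterPt_iff_frequently, frequently_cofinite_iff_infinite]
  rfl

theorem isClosed_limitPoints (a : ℤ → ℂ) : IsClosed (limitPoints a) := by
  have : limitPoints a = {z | ClusterPt z (map a cofinite)} := Set.ext fun z => mem_limitPoints_iff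
  rw [this]
  exact isClosed_setOfPred_clusterPt

theorem mem_limitPoints_of_tendsto {n : ℕ → ℤ} (hn : Tendsto n atTop cofinite)
    (h : Tendsto (fun j => a (n j)) atTop (𝓝 z)) : z ∈ limitPoints a :=
  mem_limitPoints_iff.2 (MapClusterPt.of_comp hn (Tendsto.mapClusterPt h))

theorem limitPoints_subset_closure_range (a : ℤ → ℂ) :
    limitPoints a ⊆ closure (Set.range a) := fun _ hz =>
  mem_closure_iff_nhds.2 fun U hU =>
    let ⟨n, hn⟩ := (hz U hU).nonempty
    ⟨a n, hn, n, rfl⟩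

theorem closure_range_subset (a : ℤ → ℂ) : closure (Set.range a) ⊆ Set.range a ∪ limitPoints a := by
  intro z hz
  by_contra! hcon
  rw [Set.mem_union, not_or] at hcon
  obtain ⟨hrange, hlim⟩ := hcon
  have hfin : ∃ U ∈ 𝓝 z, {n : ℤ | a n ∈ U}.Finite := by
    simpa [limitPoints] using hlim
  obtain ⟨U, hU, hfin⟩ := hfin
  have hV : U ∩ (a '' {n : ℤ | a n ∈ U})ᶜ ∈ 𝓝 z :=
    inter_mem hU ((hfin.image a).isClosed.isOpen_compl.mem_nhds fun ⟨n, _, hn⟩ => hrange ⟨n, hn⟩)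
  obtain ⟨_, ⟨hmem, hnotMem⟩, n, rfl⟩ := mem_closure_iff_nhds.1 hz _ hV
  exact hnotMem ⟨n, hmem, rfl⟩

theorem pow_succ_mem_limitPoints {w : ℂ} (h1 : 1 ∈ Set.range a)
    (h : ∀ n, a n * w ∈ limitPoints a) (r : ℕ) : w ^ (r + 1) ∈ limitPoints a := by
  have hmul : Set.MapsTo (· * w) (closure (Set.range a)) (limitPoints a) :=
    (isClosed_limitPoints a).closure_eq ▸
      (Set.mapsTo_range_iff.2 h).closure (continuous_mul_const w)
  induction r with
  | zero => simpa using hmul (subset_closure h1)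
  | succ r ih => exact pow_succ w (r + 1) ▸ hmul (limitPoints_subset_closure_range a ih)

end LimitPoints

section Infinite

open scoped translate

variable {θ : ℝ} {N : ℤ → ℤ}

theorem tendsto_cosProd_add_indicator_translate {u g r : ℤ → ℝ} (hu : Summable u)
    (hg : Summable g) (hr : Summable r) {c : ℕ → ℝ} (hc : Tendsto c atTop (𝓝 0)) :
    Tendsto (fun j : ℕ => cosProd (u + ((Set.Ici 0).indicator (τ (j : ℤ) g) + c j • r))) atTop
      (𝓝 (cosProd u * cosProd g)) := by
  have hτ : ∀ j : ℕ, Summable (τ (j : ℤ) g) := fun j => summable_translate hg _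
  have happrox : Tendsto (fun j : ℕ => cosProd (u + ((Set.Ici 0).indicator (τ (j : ℤ) g) +
      c j • r)) - cosProd (u + τ (j : ℤ) g)) atTop (𝓝 0) := by
    refine tendsto_cosProd_sub
      (fun j => hu.add (((hτ j).indicator _).add (hr.const_smul (c j))))
      (fun j => hu.add (hτ j)) ?_
    simp only [Pi.add_apply u, add_sub_add_left_eq_sub]
    exact tendsto_tsum_abs_indicator_translate_add_smul_sub hg hr tendsto_natCast_atTop_atTop hc
  have hmul : Tendsto (fun j : ℕ => cosProd (u + τ (j : ℤ) g) -
      cosProd u * cosProd (τ (j : ℤ) g)) atTop (𝓝 0) := by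
    refine tendsto_cosProd_add_sub_mul (M := ∑' k, |g k|) hu hτ
      (fun j k => hg.abs.le_tsum _ fun _ _ => abs_nonneg _) fun k => ?_
    refine hg.tendsto_cofinite_zero.comp (Nat.cofinite_eq_atTop ▸
      Function.Injective.tendsto_cofinite fun i j hij => ?_)
    simpa using hij
  have h := (happrox.add hmul).add_const (cosProd u * cosProd g)
  rw [add_zero, zero_add] at h
  refine h.congr fun j => ?_
  rw [cosProd_translate]
  ring

theorem cos_pi_mul_two_mul_sub_intCast (x : ℝ) (n : ℤ) :
    Real.cos (Real.pi * (2 * (x - n))) = Real.cos (2 * Real.pi * x) := by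
  rw [← Real.cos_sub_int_mul_two_pi (2 * Real.pi * x) n]
  ring_nf

theorem cos_two_pi_mul_zpow_ne_zero (hθ : IsPisot θ) (hirr : Irrational θ) (k : ℤ) :
    Real.cos (2 * Real.pi * θ ^ k) ≠ 0 := by
  intro h
  obtain ⟨i, hi⟩ := Real.cos_eq_zero_iff.1 h
  have hquarter : θ ^ k = (2 * i + 1) / 4 := by
    field_simp at hi
    linarith
  rcases eq_or_ne k 0 with rfl | hk
  · rw [zpow_zero, eq_div_iff four_ne_zero, one_mul] at hquarter
    have : (4 : ℤ) = 2 * i + 1 := by exact_mod_cast hquarter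
    omega
  · exact irrational_zpow hθ hirr hk ⟨(2 * i + 1) / 4, by push_cast; exact hquarter.symm⟩

theorem abs_cos_two_pi_mul_lt_one {x : ℝ} (hx : Irrational x) :
    |Real.cos (2 * Real.pi * x)| < 1 := by
  refine (Real.abs_cos_le_one _).lt_of_ne fun h => ?_
  obtain ⟨i, hi⟩ := Real.abs_cos_eq_one_iff.1 h
  refine hx ⟨i / 2, ?_⟩
  push_cast
  rw [div_eq_iff two_ne_zero]
  exact mul_left_cancel₀ Real.pi_ne_zero (by linarith)

theorem cosProd_zpow_sub_ne_zero (hθ : IsPisot θ) (hirr : Irrational θ)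
    (hN : Summable fun k : ℤ => θ ^ (-k) - N k) :
    cosProd (fun k : ℤ => 2 * (θ ^ (-k) - N k)) ≠ 0 :=
  cosProd_ne_zero (hN.mul_left 2) fun k => by
    rw [cos_pi_mul_two_mul_sub_intCast]
    exact cos_two_pi_mul_zpow_ne_zero hθ hirr _

theorem abs_cosProd_zpow_sub_lt_one (hirr : Irrational θ)
    (hN : Summable fun k : ℤ => θ ^ (-k) - N k) :
    |cosProd fun k : ℤ => 2 * (θ ^ (-k) - N k)| < 1 := by
  refine (abs_cosProd_le_prod (hN.mul_left 2) {-1}).trans_lt ?_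
  rw [Finset.prod_singleton, cos_pi_mul_two_mul_sub_intCast, neg_neg, zpow_one]
  exact abs_cos_two_pi_mul_lt_one hirr

theorem tendsto_intCast_sub_pow (hN : Summable fun k : ℤ => θ ^ (-k) - N k) :
    Tendsto (fun j : ℕ => (N (-j) : ℝ) - θ ^ j) atTop (𝓝 0) := by
  have hinj : Function.Injective fun j : ℕ => (-j : ℤ) := neg_injective.comp Nat.cast_injective
  have h := hN.tendsto_cofinite_zero.comp hinj.tendsto_cofinite
  rw [Nat.cofinite_eq_atTop] at h
  simpa using h.neg

theorem tendsto_intCast_atTop_of_summable (hθ : 1 < θ)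
    (hN : Summable fun k : ℤ => θ ^ (-k) - N k) :
    Tendsto (fun j : ℕ => N (-j)) atTop atTop := by
  rw [← tendsto_intCast_atTop_iff (R := ℝ)]
  simpa using (tendsto_intCast_sub_pow hN).add_atTop (tendsto_pow_atTop_atTop_of_one_lt hθ)

theorem tendsto_measureFourierCoeff_add (hθ : 1 < θ)
    (hN : Summable fun k : ℤ => θ ^ (-k) - N k) (m : ℤ) :
    Tendsto (fun j : ℕ => measureFourierCoeff (circleBernoulli θ) (m + N (-j))) atTop
      (𝓝 (measureFourierCoeff (circleBernoulli θ) m *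
        (cosProd fun k : ℤ => 2 * (θ ^ (-k) - N k) : ℝ))) := by
  have hh := summable_halfGeom hθ
  have hlim := tendsto_cosProd_add_indicator_translate (hh.const_smul (2 * m : ℝ))
    (hN.mul_left 2) hh (by simpa using (tendsto_intCast_sub_pow hN).const_mul 2)
  simp only [measureFourierCoeff_eq_cosProd hθ, ← Complex.ofReal_mul]
  refine (Complex.continuous_ofReal.tendsto _).comp (hlim.congr fun j => ?_)
  rw [← cosProd_add_two_mul_intCast _ ((Set.Ici 0).indicator (τ (j : ℤ) N))]
  congr 1
  funext k
  rcases le_or_gt 0 k with hk | hk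
  · have hpow : θ ^ (-(k - j : ℤ)) = θ ^ j * θ ^ (-k) := by
      rw [← zpow_natCast, ← zpow_add₀ (by positivity)]
      ring_nf
    simp only [Pi.add_apply, Pi.smul_apply, smul_eq_mul, Set.indicator_of_mem (Set.mem_Ici.2 hk),
      translate_apply, halfGeom_of_nonneg θ hk, hpow]
    push_cast
    ring
  · simp [halfGeom, hk]

theorem limitPoints_infinite (hθ : IsPisot θ) (hirr : Irrational θ) :
    (limitPoints (measureFourierCoeff (circleBernoulli θ))).Infinite := by
  obtain ⟨N, hN⟩ := exists_intCast_summable_zpow_neg_sub hθ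
  set Φ := cosProd fun k : ℤ => 2 * (θ ^ (-k) - N k)
  have hpow := pow_succ_mem_limitPoints (w := (Φ : ℂ))
    (a := measureFourierCoeff (circleBernoulli θ)) ⟨0, by simp [measureFourierCoeff]⟩ fun m =>
      mem_limitPoints_of_tendsto
        ((tendsto_atTop_add_const_left _ m (tendsto_intCast_atTop_of_summable hθ.1 hN)).mono_right
          atTop_le_cofinite) (tendsto_measureFourierCoeff_add hθ.1 hN m)
  refine Set.infinite_of_injective_forall_mem (fun r s hrs => ?_) hpow
  have habs : |Φ| ^ (r + 1) = |Φ| ^ (s + 1) := by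
    simpa using congrArg norm hrs
  have hinj := pow_right_injective₀ (abs_pos.2 (cosProd_zpow_sub_ne_zero hθ hirr hN))
    (abs_cosProd_zpow_sub_lt_one hirr hN).ne
  exact Nat.succ_injective (hinj habs)

end Infinite

/-! ### The recurrence of the minimal polynomial -/

section Recurrence

open Polynomial
open scoped translate

/-- The shift `(S f) k = f (k - 1)` on doubly infinite sequences. A polynomial in `S` is a linear
recurrence operator with constant coefficients. -/
def shift (R : Type*) [CommRing R] : Module.End R (ℤ → R) := LinearMap.funLeft R R fun k => k - 1

section Shift

variable {R R' : Type*} [CommRing R] [CommRing R']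

theorem shift_apply (f : ℤ → R) (k : ℤ) : shift R f k = f (k - 1) := rfl

theorem shift_pow_apply (i : ℕ) (f : ℤ → R) (k : ℤ) : (shift R ^ i) f k = f (k - i) := by
  induction i generalizing k with
  | zero => simp
  | succ i ih =>
    rw [pow_succ', Module.End.mul_apply, shift_apply, ih]
    congr 1; push_cast; ring

theorem aeval_shift_apply (P : ℤ[X]) (f : ℤ → R) (k : ℤ) :
    aeval (shift R) P f k = ∑ i ∈ Finset.range (P.natDegree + 1), P.coeff i • f (k - i) := by
  rw [aeval_eq_sum_range, LinearMap.sum_apply, Finset.sum_apply]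
  refine Finset.sum_congr rfl fun i _ => ?_
  rw [LinearMap.smul_apply, Pi.smul_apply, shift_pow_apply]

theorem map_aeval_shift_apply (φ : R →+ R') (P : ℤ[X]) (f : ℤ → R) (k : ℤ) :
    φ (aeval (shift R) P f k) = aeval (shift R') P (φ ∘ f) k := by
  simp only [aeval_shift_apply, map_sum, map_zsmul, Function.comp_apply]

theorem aeval_shift_X_sub_C_apply (α : R) (f : ℤ → R) (k : ℤ) :
    aeval (shift R) (X - C α) f k = f (k - 1) - α * f k := by
  simp [shift_apply, Algebra.algebraMap_eq_smul_one]

theorem aeval_shift_prod_cons (α : R) (s : Multiset R) (f : ℤ → R) :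
    aeval (shift R) ((α ::ₘ s).map fun β => X - C β).prod f =
      aeval (shift R) (s.map fun β => X - C β).prod (aeval (shift R) (X - C α) f) := by
  rw [Multiset.map_cons, Multiset.prod_cons, mul_comm, map_mul, Module.End.mul_apply]

end Shift

section Solutions

variable {α β : ℂ}

theorem exists_summable_eq_add_mul (hβ : ‖β‖ < 1) {g : ℤ → ℂ} (hg : Summable g) (t : ℤ) :
    ∃ h : ℤ → ℂ, Summable h ∧ ∀ k, h k = g k + β * h (k + t) := by
  have hprod : Summable fun z : ℤ × ℕ => g z.1 * β ^ z.2 :=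
    summable_mul_of_summable_norm hg.norm (summable_norm_geometric_of_norm_lt_one hβ)
  let e : ℤ × ℕ ≃ ℤ × ℕ :=
    { toFun := fun z => (z.1 + z.2 * t, z.2)
      invFun := fun z => (z.1 - z.2 * t, z.2)
      left_inv := fun z => by simp
      right_inv := fun z => by simp }
  have hsheared : Summable fun z : ℤ × ℕ => g (z.1 + z.2 * t) * β ^ z.2 := e.summable_iff.2 hprod
  refine ⟨fun k => ∑' j : ℕ, g (k + j * t) * β ^ j, hsheared.prod, fun k => ?_⟩
  have hfibre : Summable fun j : ℕ => g (k + j * t) * β ^ j := hsheared.prod_factor k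
  beta_reduce
  rw [hfibre.tsum_eq_zero_add, ← tsum_mul_left]
  congr 1
  · simp
  · refine tsum_congr fun j => ?_
    rw [pow_succ', show k + ((j + 1 : ℕ) : ℤ) * t = k + t + j * t by push_cast; ring]
    ring

theorem exists_summable_aeval_shift_X_sub_C_eq (hα : ‖α‖ ≠ 1) {g : ℤ → ℂ} (hg : Summable g) :
    ∃ h : ℤ → ℂ, Summable h ∧ aeval (shift ℂ) (X - C α) h = g := by
  rcases hα.lt_or_gt with hα | hα
  · obtain ⟨h, hs, hh⟩ := exists_summable_eq_add_mul hα hg 1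
    refine ⟨fun k => h (k + 1), (Equiv.addRight (1 : ℤ)).summable_iff.2 hs, funext fun k => ?_⟩
    rw [aeval_shift_X_sub_C_apply, sub_add_cancel, hh k, add_sub_cancel_right]
  · have hα0 : α ≠ 0 := norm_pos_iff.1 (zero_lt_one.trans hα)
    obtain ⟨h, hs, hh⟩ := exists_summable_eq_add_mul (β := α⁻¹)
      (by rw [norm_inv]; exact inv_lt_one_of_one_lt₀ hα) hg (-1)
    refine ⟨fun k => -α⁻¹ * h k, hs.mul_left _, funext fun k => ?_⟩
    rw [aeval_shift_X_sub_C_apply, sub_eq_add_neg k 1, hh k]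
    field_simp
    ring

theorem exists_summable_aeval_shift_prod_eq (s : Multiset ℂ) (hs : ∀ α ∈ s, ‖α‖ ≠ 1) {g : ℤ → ℂ}
    (hg : Summable g) :
    ∃ G : ℤ → ℂ, Summable G ∧ aeval (shift ℂ) (s.map fun α => X - C α).prod G = g := by
  induction s using Multiset.induction_on with
  | empty => exact ⟨g, hg, by simp⟩
  | cons α s ih =>
    obtain ⟨G, hG, hGs⟩ := ih fun β hβ => hs β (Multiset.mem_cons_of_mem hβ)
    obtain ⟨h, hh, hhs⟩ :=
      exists_summable_aeval_shift_X_sub_C_eq (hs α (Multiset.mem_cons_self α s)) hG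
    exact ⟨h, hh, by rw [aeval_shift_prod_cons, hhs, hGs]⟩

variable {w : ℤ → ℂ} {N : ℤ} {M : ℝ}

theorem norm_aeval_shift_X_sub_C_le (α : ℂ) (hM : ∀ k, N ≤ k → ‖w k‖ ≤ M) {k : ℤ}
    (hk : N + 1 ≤ k) : ‖aeval (shift ℂ) (X - C α) w k‖ ≤ M + ‖α‖ * M := by
  rw [aeval_shift_X_sub_C_apply]
  refine (norm_sub_le _ _).trans ?_
  rw [norm_mul]
  gcongr
  · exact hM _ (by omega)
  · exact hM _ (by omega)

theorem eq_zero_of_eq_mul_add_one (hα : ‖α‖ < 1) (hM : ∀ k, N ≤ k → ‖w k‖ ≤ M)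
    (hw : ∀ k, N ≤ k → w k = α * w (k + 1)) {k : ℤ} (hk : N ≤ k) : w k = 0 := by
  have hiter : ∀ j : ℕ, w k = α ^ j * w (k + j) := by
    intro j
    induction j with
    | zero => simp
    | succ j ih =>
      rw [ih, hw (k + j) (by omega), pow_succ, mul_assoc]
      push_cast
      ring_nf
  have hbound : ∀ j : ℕ, ‖w k‖ ≤ ‖α‖ ^ j * M := fun j => by
    rw [hiter j, norm_mul, norm_pow]
    gcongr
    exact hM _ (by omega)
  have hlim : Tendsto (fun j : ℕ => ‖α‖ ^ j * M) atTop (𝓝 0) := by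
    simpa using (tendsto_pow_atTop_nhds_zero_of_lt_one (norm_nonneg α) hα).mul_const M
  exact norm_le_zero_iff.1 (ge_of_tendsto' hlim hbound)

theorem eq_zero_of_aeval_shift_eq_zero (s : Multiset ℂ) (hs : ∀ α ∈ s, ‖α‖ < 1)
    (hM : ∀ k, N ≤ k → ‖w k‖ ≤ M)
    (hw : ∀ k, N + s.card ≤ k → aeval (shift ℂ) (s.map fun α => X - C α).prod w k = 0) {k : ℤ}
    (hk : N ≤ k) : w k = 0 := by
  induction s using Multiset.induction_on generalizing w N M k with
  | empty => simpa using hw k (by simpa using hk)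
  | cons α s ih =>
    have hzero : ∀ k, N + 1 ≤ k → aeval (shift ℂ) (X - C α) w k = 0 := fun k =>
      ih (fun β hβ => hs β (Multiset.mem_cons_of_mem hβ))
        (fun _ => norm_aeval_shift_X_sub_C_le α hM) (fun k hk => by
          rw [← aeval_shift_prod_cons]
          exact hw k (by rw [Multiset.card_cons]; push_cast; omega))
    refine eq_zero_of_eq_mul_add_one (hs α (Multiset.mem_cons_self α s)) hM (fun k hk => ?_) hk
    have h := hzero (k + 1) (by omega)
    rwa [aeval_shift_X_sub_C_apply, add_sub_cancel_right, sub_eq_zero] at h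

end Solutions

variable {θ : ℝ}

/-- The linear recurrence operator given by the minimal polynomial of `θ` over `ℤ`; it annihilates
the sequence `θ⁻ᵏ`. -/
def recur (θ : ℝ) : Module.End ℝ (ℤ → ℝ) := aeval (shift ℝ) (minpoly ℤ θ)

theorem recur_apply (f : ℤ → ℝ) (k : ℤ) :
    recur θ f k = ∑ i ∈ Finset.range ((minpoly ℤ θ).natDegree + 1),
      ((minpoly ℤ θ).coeff i : ℝ) * f (k - i) := by
  simp only [recur, aeval_shift_apply, zsmul_eq_mul]

theorem recur_translate (j : ℤ) (f : ℤ → ℝ) : recur θ (τ j f) = τ j (recur θ f) := by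
  funext k
  simp only [recur_apply, translate_apply, sub_right_comm]

theorem recur_zpow_neg (hθ : θ ≠ 0) : recur θ (fun k => θ ^ (-k)) = 0 := by
  funext k
  have h := congrArg (θ ^ (-k) * ·) (minpoly.aeval ℤ θ)
  simp only [aeval_eq_sum_range, mul_zero, Finset.mul_sum] at h
  rw [recur_apply, Pi.zero_apply, ← h]
  refine Finset.sum_congr rfl fun i _ => ?_
  rw [neg_sub, sub_eq_add_neg, zpow_add₀ hθ, zpow_natCast, zsmul_eq_mul]
  ring

theorem recur_congr {f g : ℤ → ℝ} {k : ℤ} (h : ∀ i ≤ (minpoly ℤ θ).natDegree,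
    f (k - i) = g (k - i)) : recur θ f k = recur θ g k := by
  rw [recur_apply, recur_apply]
  exact Finset.sum_congr rfl fun i hi => by rw [h i (Nat.lt_succ_iff.1 (Finset.mem_range.1 hi))]

theorem exists_recur_intCast (N : ℤ → ℤ) (k : ℤ) : ∃ b : ℤ, recur θ (fun k => N k) k = b := by
  refine ⟨∑ i ∈ Finset.range ((minpoly ℤ θ).natDegree + 1), (minpoly ℤ θ).coeff i * N (k - i), ?_⟩
  rw [recur_apply]
  push_cast
  rfl

/-- The length of the minimal polynomial of `θ`, i.e. the sum of the absolute values of its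
coefficients; it bounds the norm of `recur θ` on bounded sequences. -/
def minpolyLength (θ : ℝ) : ℝ :=
  ∑ i ∈ Finset.range ((minpoly ℤ θ).natDegree + 1), |((minpoly ℤ θ).coeff i : ℝ)|

theorem minpolyLength_nonneg (θ : ℝ) : 0 ≤ minpolyLength θ :=
  Finset.sum_nonneg fun _ _ => abs_nonneg _

theorem abs_recur_le {f : ℤ → ℝ} {k : ℤ} {ε : ℝ}
    (h : ∀ i ≤ (minpoly ℤ θ).natDegree, |f (k - i)| ≤ ε) :
    |recur θ f k| ≤ minpolyLength θ * ε := by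
  rw [recur_apply, minpolyLength, Finset.sum_mul]
  refine (Finset.abs_sum_le_sum_abs _ _).trans (Finset.sum_le_sum fun i hi => ?_)
  rw [abs_mul]
  exact mul_le_mul_of_nonneg_left (h i (Nat.lt_succ_iff.1 (Finset.mem_range.1 hi))) (abs_nonneg _)

theorem exists_minpoly_map_eq_prod (hθ : IsPisot θ) : ∃ s : Multiset ℂ, (∀ α ∈ s, ‖α‖ < 1) ∧
    (minpoly ℤ θ).map (algebraMap ℤ ℂ) = ((θ : ℂ) ::ₘ s |>.map fun α => X - C α).prod := by
  have hθQ : IsIntegral ℚ θ := hθ.2.1.tower_top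
  have hmap : (minpoly ℤ θ).map (algebraMap ℤ ℂ) = (minpoly ℚ θ).map (algebraMap ℚ ℂ) := by
    rw [minpoly.isIntegrallyClosed_eq_field_fractions' ℚ hθ.2.1, Polynomial.map_map]
    rfl
  have hnodup : ((minpoly ℚ θ).aroots ℂ).Nodup :=
    nodup_roots (minpoly.irreducible hθQ).separable.map
  have hmem : (θ : ℂ) ∈ (minpoly ℚ θ).aroots ℂ := by
    have h := aeval_algHom_apply (Complex.ofRealAm.restrictScalars ℚ) θ (minpoly ℚ θ)
    rw [minpoly.aeval, map_zero] at h
    exact mem_aroots.2 ⟨minpoly.ne_zero hθQ, h⟩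
  refine ⟨((minpoly ℚ θ).aroots ℂ).erase θ, fun α hα => ?_, ?_⟩
  · exact hθ.2.2 α (Multiset.mem_of_mem_erase hα) (hnodup.mem_erase_iff.1 hα).1
  · rw [Multiset.cons_erase hmem, hmap]
    exact (IsAlgClosed.splits _).eq_prod_roots_of_monic ((minpoly.monic hθQ).map _)

theorem exists_summable_recur_eq_single (hθ : IsPisot θ) :
    ∃ G : ℤ → ℝ, Summable G ∧ recur θ G = Pi.single 0 1 := by
  obtain ⟨s, hs, hp⟩ := exists_minpoly_map_eq_prod hθ
  have hroots : ∀ α ∈ (θ : ℂ) ::ₘ s, ‖α‖ ≠ 1 := by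
    refine Multiset.forall_mem_cons.2 ⟨?_, fun α hα => (hs α hα).ne⟩
    rw [Complex.norm_real, Real.norm_of_nonneg (zero_le_one.trans hθ.1.le)]
    exact hθ.1.ne'
  obtain ⟨G, hG, hGs⟩ := exists_summable_aeval_shift_prod_eq _ hroots
    (summable_of_hasFiniteSupport (f := Pi.single (0 : ℤ) (1 : ℂ)) (by
      exact (Set.finite_singleton 0).subset Pi.support_single_subset))
  rw [← hp, aeval_map_algebraMap] at hGs
  refine ⟨Complex.reLm ∘ G, (Complex.hasSum_re hG.hasSum).summable, funext fun k => ?_⟩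
  rw [recur, ← AddMonoidHom.coe_coe Complex.reLm, ← map_aeval_shift_apply, hGs]
  by_cases hk : k = 0 <;> simp [hk]

/-- A Pisot recurrence has a single root outside the unit disc, so that its bounded solutions on the
half line are multiples of `θ⁻ᵏ`. -/
theorem eq_mul_zpow_neg_of_recur_eq_zero (hθ : IsPisot θ) {h : ℤ → ℝ} {M : ℝ}
    (hM : ∀ k, 0 ≤ k → |h k| ≤ M) (hh : ∀ k : ℤ, (minpoly ℤ θ).natDegree ≤ k → recur θ h k = 0)
    {k : ℤ} (hk : 0 ≤ k) : h k = h 0 * θ ^ (-k) := by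
  obtain ⟨s, hs, hp⟩ := exists_minpoly_map_eq_prod hθ
  have hdeg : (minpoly ℤ θ).natDegree = s.card + 1 := by
    rw [← (minpoly.monic hθ.2.1).natDegree_map (algebraMap ℤ ℂ), hp,
      natDegree_multiset_prod_X_sub_C_eq_card, Multiset.card_cons]
  let hC : ℤ → ℂ := Complex.ofRealHom.toAddMonoidHom ∘ h
  have hzero : ∀ k : ℤ, 1 ≤ k → aeval (shift ℂ) (X - C (θ : ℂ)) hC k = 0 := fun k =>
    eq_zero_of_aeval_shift_eq_zero s hs (N := 1) (fun k => norm_aeval_shift_X_sub_C_le (θ : ℂ)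
      (N := 0) (M := M) fun k hk => (Complex.norm_real (h k)).trans_le (hM k hk)) fun k hk => by
        rw [← aeval_shift_prod_cons, ← hp, aeval_map_algebraMap]
        refine (map_aeval_shift_apply Complex.ofRealHom.toAddMonoidHom _ h k).symm.trans ?_
        exact (congrArg _ (hh k (by rw [hdeg]; push_cast; omega))).trans (map_zero _)
  have h0 : θ ≠ 0 := (zero_lt_one.trans hθ.1).ne'
  induction k, hk using Int.leInduction with
  | base => simp
  | succ k hk ih =>
    have h2 := hzero (k + 1) (by omega)
    rw [aeval_shift_X_sub_C_apply, add_sub_cancel_right, sub_eq_zero] at h2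
    have h3 : h k = θ * h (k + 1) := Complex.ofReal_injective (by rw [Complex.ofReal_mul]; exact h2)
    rw [neg_add, zpow_add₀ h0, ← mul_assoc, ← ih, h3, zpow_neg_one]
    field_simp

end Recurrence

/-! ### Superpositions of translates -/

section Superpose

open scoped translate

variable {A : Type*} [AddCommGroup A] {G : A → ℝ}

/-- The superposition `∑ⱼ bⱼ τⱼ G` of translates of `G`, i.e. the convolution of `b` with `G`. -/
def superpose (G : A → ℝ) : (A →₀ ℤ) →ₗ[ℤ] (A → ℝ) :=
  Finsupp.linearCombination ℤ fun j => τ j G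

theorem superpose_single (j : A) (c : ℤ) :
    superpose G (Finsupp.single j c) = (c : ℝ) • τ j G := by
  rw [superpose, Finsupp.linearCombination_single, Int.cast_smul_eq_zsmul]

theorem superpose_sum_single {ι : Type*} (I : Finset ι) (c : ι → ℤ) (j : ι → A) :
    superpose G (∑ i ∈ I, Finsupp.single (j i) (c i)) = ∑ i ∈ I, (c i : ℝ) • τ (j i) G := by
  simp only [map_sum, superpose_single]

theorem summable_superpose (hG : Summable G) (b : A →₀ ℤ) : Summable (superpose G b) := by
  induction b using Finsupp.induction_linear with
  | zero => rw [map_zero]; exact summable_zero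
  | add b b' hb hb' => rw [map_add]; exact hb.add hb'
  | single j c => rw [superpose_single]; exact (summable_translate hG j).const_smul (c : ℝ)

theorem recur_superpose {θ : ℝ} {G : ℤ → ℝ} (hG : recur θ G = Pi.single 0 1) (b : ℤ →₀ ℤ) :
    recur θ (superpose G b) = fun k => (b k : ℝ) := by
  induction b using Finsupp.induction_linear with
  | zero => funext k; simp
  | add b b' hb hb' => funext k; simp [hb, hb']
  | single j c =>
    funext k
    rw [superpose_single, map_smul, recur_translate, hG, Pi.smul_apply, translate_apply]
    by_cases hk : k = j
    · simp [hk]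
    · simp [sub_ne_zero.2 hk, Finsupp.single_eq_of_ne hk]

end Superpose

section HalfLineProj

variable {θ : ℝ}

/-- Restriction to the half line `k ≥ 0`, corrected by a multiple of `θ⁻ᵏ` so as to vanish at
`0`. -/
def halfLineProj (θ : ℝ) : (ℤ → ℝ) →ₗ[ℝ] (ℤ → ℝ) where
  toFun f := (Set.Ici 0).indicator f - f 0 • halfGeom θ
  map_add' f g := by rw [Set.indicator_add', Pi.add_apply, add_smul, add_sub_add_comm]
  map_smul' c f := by
    rw [RingHom.id_apply, smul_sub, Pi.smul_apply, smul_assoc]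
    congr 1
    exact Set.indicator_const_smul _ c f

theorem halfLineProj_apply (f : ℤ → ℝ) :
    halfLineProj θ f = (Set.Ici 0).indicator f - f 0 • halfGeom θ := rfl

theorem halfLineProj_apply_of_nonneg (f : ℤ → ℝ) {k : ℤ} (hk : 0 ≤ k) :
    halfLineProj θ f k = f k - f 0 * θ ^ (-k) := by
  rw [halfLineProj_apply, Pi.sub_apply, Set.indicator_of_mem (Set.mem_Ici.2 hk), Pi.smul_apply,
    halfGeom_of_nonneg θ hk, smul_eq_mul]

theorem halfLineProj_apply_of_neg (f : ℤ → ℝ) {k : ℤ} (hk : k < 0) : halfLineProj θ f k = 0 := by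
  have hk' : k ∉ Set.Ici 0 := Set.notMem_Ici.2 hk
  simp [halfLineProj_apply, halfGeom, Set.indicator_of_notMem hk']

theorem summable_halfLineProj (hθ : 1 < θ) {f : ℤ → ℝ} (hf : Summable f) :
    Summable (halfLineProj θ f) :=
  (hf.indicator _).sub ((summable_halfGeom hθ).const_smul (f 0))

end HalfLineProj

/-! ### Large Fourier coefficients -/

section Decomposition

variable {θ : ℝ}

theorem abs_cos_pi_mul_le {ε x : ℝ} (hε : 0 ≤ ε) (hx : ε ≤ |x - round x|) :
    |Real.cos (Real.pi * x)| ≤ Real.cos (Real.pi * ε) := by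
  have hπ := Real.pi_pos
  have hhalf : Real.pi * |x - round x| ≤ Real.pi / 2 := by nlinarith [abs_sub_round x]
  have hround : |Real.cos (Real.pi * x)| = |Real.cos (Real.pi * |x - round x|)| := by
    rw [← abs_of_pos hπ, ← abs_mul, Real.cos_abs, abs_of_pos hπ, mul_sub,
      mul_comm Real.pi (round x : ℝ), Real.cos_sub_int_mul_pi, abs_mul, abs_zpow, abs_neg, abs_one,
      one_zpow, one_mul]
  rw [hround, abs_of_nonneg (Real.cos_nonneg_of_neg_pi_div_two_le_of_le
    (by nlinarith [abs_nonneg (x - round x)]) hhalf)]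
  exact Real.cos_le_cos_of_nonneg_of_le_pi (by positivity) (by linarith) (by gcongr)

theorem exists_card_le_of_le_abs_cosProd {ι : Type*} {ε δ : ℝ} (hε : 0 < ε) (hδ : 0 < δ) :
    ∃ m : ℕ, ∀ u : ι → ℝ, Summable u → δ ≤ |cosProd u| →
      ∃ s : Finset ι, s.card ≤ m ∧ ∀ k, ε ≤ |u k - round (u k)| → k ∈ s := by
  have hη : 0 < min ε (1 / 2) := lt_min hε one_half_pos
  have hη' : min ε (1 / 2) ≤ 1 / 2 := min_le_right _ _
  set q := Real.cos (Real.pi * min ε (1 / 2))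
  have hπ := Real.pi_pos
  have hq0 : 0 ≤ q := Real.cos_nonneg_of_neg_pi_div_two_le_of_le (by nlinarith) (by nlinarith)
  have hq1 : q < 1 := by
    have h := Real.cos_lt_cos_of_nonneg_of_le_pi le_rfl (by nlinarith) (mul_pos hπ hη)
    rwa [Real.cos_zero] at h
  obtain ⟨m, hm⟩ := exists_pow_lt_of_lt_one hδ hq1
  refine ⟨m, fun u hu hδu => ?_⟩
  have hcard : ∀ t : Finset ι, (∀ k ∈ t, ε ≤ |u k - round (u k)|) → t.card ≤ m := by
    intro t ht
    by_contra! hmt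
    have h : |cosProd u| ≤ q ^ t.card := by
      refine (abs_cosProd_le_prod hu t).trans ?_
      rw [← Finset.prod_const]
      exact Finset.prod_le_prod (fun _ _ => abs_nonneg _) fun k hk =>
        abs_cos_pi_mul_le hη.le ((min_le_left _ _).trans (ht k hk))
    linarith [pow_le_pow_of_le_one hq0 hq1.le hmt.le]
  have hfin : {k | ε ≤ |u k - round (u k)|}.Finite := by
    by_contra hinf
    obtain ⟨t, hts, ht⟩ := Set.Infinite.exists_subset_card_eq hinf (m + 1)
    have := hcard t fun k hk => hts hk
    omega
  exact ⟨hfin.toFinset, hcard _ fun k hk => (hfin.mem_toFinset).1 hk,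
    fun k hk => hfin.mem_toFinset.2 hk⟩

theorem exists_int_recur_sub_round {u : ℤ → ℝ} {k : ℤ} (hu : recur θ u k = 0) :
    ∃ b : ℤ, recur θ (fun k => u k - round (u k)) k = b := by
  obtain ⟨b, hb⟩ := exists_recur_intCast (θ := θ) (fun k => round (u k)) k
  refine ⟨-b, ?_⟩
  change recur θ (u - fun k => (round (u k) : ℝ)) k = _
  rw [map_sub, Pi.sub_apply, hu, hb, zero_sub, Int.cast_neg]

theorem exists_le_abs_of_recur_eq_intCast {e : ℤ → ℝ} {k b : ℤ} (h : recur θ e k = b)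
    (hb : b ≠ 0) : ∃ i ≤ (minpoly ℤ θ).natDegree, (minpolyLength θ + 1)⁻¹ ≤ |e (k - i)| := by
  have hL := minpolyLength_nonneg θ
  by_contra! hsmall
  have hlt : |(b : ℝ)| < 1 := by
    rw [← h]
    refine (abs_recur_le fun i hi => (hsmall i hi).le).trans_lt ?_
    rw [← div_eq_mul_inv, div_lt_one (by positivity)]
    linarith
  exact hb (Int.abs_lt_one_iff.1 (by exact_mod_cast hlt))

theorem exists_card_le_of_recur_sub_round_ne_zero (θ : ℝ) {δ : ℝ} (hδ : 0 < δ) :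
    ∃ m : ℕ, ∀ u : ℤ → ℝ, Summable u → δ ≤ |cosProd u| → ∃ t : Finset ℤ, t.card ≤ m ∧
      ∀ k b : ℤ, recur θ (fun k => u k - round (u k)) k = b → b ≠ 0 → k ∈ t := by
  classical
  have hL := minpolyLength_nonneg θ
  obtain ⟨m, hm⟩ := exists_card_le_of_le_abs_cosProd (ι := ℤ) (ε := (minpolyLength θ + 1)⁻¹)
    (by positivity) hδ
  refine ⟨((minpoly ℤ θ).natDegree + 1) * m, fun u hu hδu => ?_⟩
  obtain ⟨s, hs, hmem⟩ := hm u hu hδu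
  refine ⟨(Finset.range ((minpoly ℤ θ).natDegree + 1)).biUnion fun i => s.image (· + (i : ℤ)),
    ?_, fun k b hkb hb => ?_⟩
  · refine (Finset.card_biUnion_le_card_mul _ _ m fun i _ =>
      Finset.card_image_le.trans hs).trans_eq ?_
    rw [Finset.card_range]
  · obtain ⟨i, hi, hki⟩ := exists_le_abs_of_recur_eq_intCast hkb hb
    exact Finset.mem_biUnion.2 ⟨i, Finset.mem_range_succ_iff.2 hi,
      Finset.mem_image.2 ⟨k - i, hmem _ hki, sub_add_cancel _ _⟩⟩

theorem exists_finsupp_recur_sub_round (θ : ℝ) {δ : ℝ} (hδ : 0 < δ) :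
    ∃ m B : ℕ, ∀ u : ℤ → ℝ, Summable u → δ ≤ |cosProd u| →
      (∀ k : ℤ, (minpoly ℤ θ).natDegree ≤ k → recur θ u k = 0) →
      ∃ b : ℤ →₀ ℤ, b.support.card ≤ m ∧ (∀ k, |b k| ≤ B) ∧ (∀ k ∈ b.support, 0 ≤ k) ∧
        ∀ k : ℤ, (minpoly ℤ θ).natDegree ≤ k →
          recur θ (fun k => u k - round (u k)) k = b k := by
  classical
  set d := (minpoly ℤ θ).natDegree
  obtain ⟨m, hm⟩ := exists_card_le_of_recur_sub_round_ne_zero θ hδ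
  obtain ⟨B, hB⟩ := exists_nat_ge (minpolyLength θ)
  refine ⟨m, B, fun u hu hδu hrec => ?_⟩
  obtain ⟨t, ht, hmem⟩ := hm u hu hδu
  choose! b hb using fun k hk => exists_int_recur_sub_round (hrec k hk)
  have hbound : ∀ k : ℤ, d ≤ k → |b k| ≤ B := fun k hk => by
    have h := abs_recur_le (θ := θ) (f := fun k => u k - round (u k)) (k := k) fun i _ =>
      abs_sub_round (u (k - i))
    rw [hb k hk] at h
    have h' : |(b k : ℝ)| ≤ B := by linarith [minpolyLength_nonneg θ]
    exact_mod_cast h'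
  let t' : Finset ℤ := t.filter (d ≤ ·)
  have hsupp : (Finsupp.indicator t' fun k _ => b k).support ⊆ t' :=
    Finsupp.support_indicator_subset _ _
  refine ⟨Finsupp.indicator t' fun k _ => b k,
    (Finset.card_le_card hsupp).trans ((Finset.card_filter_le _ _).trans ht), fun k => ?_,
    fun k hk => (Int.natCast_nonneg d).trans (Finset.mem_filter.1 (hsupp hk)).2, fun k hk => ?_⟩
  · by_cases hkt : k ∈ t'
    · rw [Finsupp.indicator_of_mem hkt]
      exact hbound k (Finset.mem_filter.1 hkt).2
    · simp [Finsupp.indicator_of_notMem hkt]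
  · by_cases hkt : k ∈ t'
    · rw [hb k hk, Finsupp.indicator_of_mem hkt]
    · have hbk : b k = 0 := by
        by_contra hbk
        exact hkt (Finset.mem_filter.2 ⟨hmem k (b k) (hb k hk) hbk, hk⟩)
      rw [hb k hk, Finsupp.indicator_of_notMem hkt, hbk]

theorem eq_halfLineProj_superpose (hθ : IsPisot θ) {G : ℤ → ℝ} (hG : Summable G)
    (hGr : recur θ G = Pi.single 0 1) {e : ℤ → ℝ} {M : ℝ} (he : ∀ k, |e k| ≤ M) (he0 : e 0 = 0)
    {b : ℤ →₀ ℤ} (hb : ∀ k : ℤ, (minpoly ℤ θ).natDegree ≤ k → recur θ e k = b k) {k : ℤ}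
    (hk : 0 ≤ k) : e k = halfLineProj θ (superpose G b) k := by
  have hbdd : ∀ k, |superpose G b k| ≤ ∑' k, |superpose G b k| := fun k =>
    (summable_superpose hG b).abs.le_tsum k fun _ _ => abs_nonneg _
  have hgeom := eq_mul_zpow_neg_of_recur_eq_zero hθ (h := e - superpose G b)
    (fun k _ => (abs_sub _ _).trans (add_le_add (he k) (hbdd k)))
    (fun k hk => by rw [map_sub, Pi.sub_apply, hb k hk, recur_superpose hGr, sub_self]) hk
  rw [Pi.sub_apply, Pi.sub_apply, he0] at hgeom
  rw [halfLineProj_apply_of_nonneg _ hk]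
  linarith

theorem recur_smul_halfGeom (hθ : θ ≠ 0) (c : ℝ) {k : ℤ} (hk : (minpoly ℤ θ).natDegree ≤ k) :
    recur θ (c • halfGeom θ) k = 0 := by
  rw [map_smul, Pi.smul_apply, recur_congr (g := fun k => θ ^ (-k)) fun i hi =>
    halfGeom_of_nonneg θ (by omega), recur_zpow_neg hθ, Pi.zero_apply, smul_zero]

theorem exists_abs_cosProd_eq_halfLineProj_superpose (hθ : IsPisot θ) {G : ℤ → ℝ} (hG : Summable G)
    (hGr : recur θ G = Pi.single 0 1) {δ : ℝ} (hδ : 0 < δ) :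
    ∃ m B : ℕ, ∀ n : ℤ, δ ≤ |cosProd ((2 * n : ℝ) • halfGeom θ)| →
      ∃ b : ℤ →₀ ℤ, b.support.card ≤ m ∧ (∀ k, |b k| ≤ B) ∧ (∀ k ∈ b.support, 0 ≤ k) ∧
        |cosProd ((2 * n : ℝ) • halfGeom θ)| = |cosProd (halfLineProj θ (superpose G b))| := by
  obtain ⟨m, B, h⟩ := exists_finsupp_recur_sub_round θ hδ
  refine ⟨m, B, fun n hn => ?_⟩
  set u : ℤ → ℝ := (2 * n : ℝ) • halfGeom θ with hu
  have hus : Summable u := (summable_halfGeom hθ.1).const_smul (2 * n : ℝ)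
  obtain ⟨b, hm, hB, hb0, hb⟩ :=
    h u hus hn fun k => recur_smul_halfGeom (zero_lt_one.trans hθ.1).ne' _
  have hu0 : u 0 = ((2 * n : ℤ) : ℝ) := by simp [hu, halfGeom_of_nonneg]
  have heq : ∀ k, 0 ≤ k → u k - round (u k) = halfLineProj θ (superpose G b) k := fun k =>
    eq_halfLineProj_superpose hθ hG hGr (fun k => abs_sub_round (u k))
      (by rw [hu0, round_intCast, sub_self]) hb
  refine ⟨b, hm, hB, hb0, abs_cosProd_eq_of_add_intCast hus
    (summable_halfLineProj hθ.1 (summable_superpose hG b)) (fun k => round (u k)) fun k => ?_⟩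
  rcases le_or_gt 0 k with hk | hk
  · rw [← heq k hk, sub_add_cancel]
  · have huk : u k = 0 := by
      simp [hu, halfGeom, Set.indicator_of_notMem (Set.notMem_Ici.2 hk)]
    rw [halfLineProj_apply_of_neg _ hk, huk, round_zero, Int.cast_zero, add_zero]

end Decomposition

/-! ### Cosine products along an ultrafilter -/

section Ultrafilter

variable {α β ι κ M : Type*} (U : Ultrafilter α)

theorem exists_eventually_eq_of_finite {f : α → β} {s : Set β} (hs : s.Finite)
    (h : ∀ᶠ n in U, f n ∈ s) : ∃ d, ∀ᶠ n in U, f n = d := by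
  have h' : ∀ᶠ n in U, ∃ d ∈ s, f n = d := h.mono fun n hn => ⟨f n, hn, rfl⟩
  obtain ⟨d, -, hd⟩ := (Ultrafilter.eventually_exists_mem_iff hs).1 h'
  exact ⟨d, hd⟩

theorem eventually_const_or_tendsto_cofinite (f : α → β) :
    (∃ d, ∀ᶠ n in U, f n = d) ∨ Tendsto f U cofinite := by
  refine or_iff_not_imp_right.2 fun h => ?_
  obtain ⟨s, hs, hfs⟩ := not_tendsto_iff_exists_frequently_notMem.1 h
  exact exists_eventually_eq_of_finite U (mem_cofinite.1 hs)
    (Ultrafilter.frequently_iff_eventually.1 hfs)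

theorem exists_subset_eventually_eq_and_tendsto_cofinite [DecidableEq ι] [Nonempty β]
    (j : ι → α → β) (I : Finset ι) : ∃ C ⊆ I, ∃ d : ι → β, (∀ᶠ n in U, ∀ i ∈ C, j i n = d i) ∧
      ∀ i ∈ I \ C, Tendsto (j i) U cofinite := by
  classical
  let C := I.filter fun i => ∃ d, ∀ᶠ n in U, j i n = d
  choose! d hd using fun i (hi : i ∈ C) => (Finset.mem_filter.1 hi).2
  refine ⟨C, Finset.filter_subset _ _, d, (eventually_all_finset C).2 hd, fun i hi => ?_⟩
  obtain ⟨hiI, hiC⟩ := Finset.mem_sdiff.1 hi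
  exact (eventually_const_or_tendsto_cofinite U (j i)).resolve_left fun h =>
    hiC (Finset.mem_filter.2 ⟨hiI, h⟩)

variable [AddCommMonoid M]

theorem exists_eq_sum_single (b : κ →₀ M) {r : ℕ} (hr : b.support.card = r) :
    ∃ j : Fin r → κ, (∀ i, j i ∈ b.support) ∧ b = ∑ i, Finsupp.single (j i) (b (j i)) := by
  let e := (Finset.equivFinOfCardEq hr).symm
  refine ⟨fun i => e i, fun i => (e i).2, ?_⟩
  rw [e.sum_comp fun k => Finsupp.single (k : κ) (b k),
    Finset.sum_coe_sort b.support fun k => Finsupp.single k (b k)]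
  exact b.sum_single.symm

theorem exists_eventually_eq_sum_single [Nonempty κ] (b : α → κ →₀ M) {m : ℕ} {S : Set M}
    (hS : S.Finite) (hm : ∀ᶠ n in U, (b n).support.card ≤ m) (hb : ∀ᶠ n in U, ∀ k, b n k ∈ S) :
    ∃ (r : ℕ) (c : Fin r → M) (j : Fin r → α → κ), ∀ᶠ n in U,
      (∀ i, j i n ∈ (b n).support) ∧ b n = ∑ i, Finsupp.single (j i n) (c i) := by
  obtain ⟨r, hr⟩ := exists_eventually_eq_of_finite U (Set.finite_Iic m) hm
  choose! j hj hbj using fun n (hn : (b n).support.card = r) => exists_eq_sum_single (b n) hn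
  obtain ⟨c, hc⟩ := exists_eventually_eq_of_finite U (f := fun n i => b n (j n i))
    (Set.Finite.pi fun _ : Fin r => hS) (hb.mono fun n hn i _ => hn _)
  refine ⟨r, c, fun i n => j n i, ?_⟩
  filter_upwards [hr, hc] with n hn hcn
  refine ⟨hj n hn, (hbj n hn).trans (Finset.sum_congr rfl fun i _ => ?_)⟩
  rw [← congrFun hcn i]

end Ultrafilter

section Clusters

open scoped translate

variable {α ι A : Type*} [AddCommGroup A] {G : A → ℝ}

theorem abs_superpose_sum_single_le (hG : Summable G) (I : Finset ι) (c : ι → ℤ) (j : ι → A)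
    (k : A) : |superpose G (∑ i ∈ I, Finsupp.single (j i) (c i)) k| ≤
      ∑ i ∈ I, |(c i : ℝ)| * ∑' k, |G k| := by
  rw [superpose_sum_single, Finset.sum_apply]
  refine (Finset.abs_sum_le_sum_abs _ _).trans (Finset.sum_le_sum fun i _ => ?_)
  rw [Pi.smul_apply, smul_eq_mul, abs_mul]
  exact mul_le_mul_of_nonneg_left (hG.abs.le_tsum (k - j i) fun _ _ => abs_nonneg _) (abs_nonneg _)

theorem tendsto_superpose_sum_single {l : Filter α} (hG : Summable G) {I : Finset ι} (c : ι → ℤ)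
    {j : ι → α → A} (hj : ∀ i ∈ I, Tendsto (j i) l cofinite) (k : A) :
    Tendsto (fun n => superpose G (∑ i ∈ I, Finsupp.single (j i n) (c i)) k) l (𝓝 0) := by
  have hterm : ∀ i ∈ I, Tendsto (fun n => (c i : ℝ) * G (k - j i n)) l (𝓝 0) := fun i hi => by
    simpa using (hG.tendsto_cofinite_zero.comp
      ((sub_right_injective (b := k)).tendsto_cofinite.comp (hj i hi))).const_mul (c i : ℝ)
  simpa only [superpose_sum_single, Finset.sum_apply, Pi.smul_apply, smul_eq_mul, translate_apply,
    Finset.sum_const_zero] using tendsto_finsetSum I hterm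

theorem tendsto_cosProd_add_superpose_sub_mul {l : Filter α} {u : A → ℝ} (hu : Summable u)
    (hG : Summable G) {I : Finset ι} (c : ι → ℤ) {j : ι → α → A}
    (hj : ∀ i ∈ I, Tendsto (j i) l cofinite) :
    Tendsto (fun n => cosProd (u + superpose G (∑ i ∈ I, Finsupp.single (j i n) (c i))) -
      cosProd u * cosProd (superpose G (∑ i ∈ I, Finsupp.single (j i n) (c i)))) l (𝓝 0) :=
  tendsto_cosProd_add_sub_mul hu (fun _ => summable_superpose hG _)
    (fun n => abs_superpose_sum_single_le hG I c fun i => j i n)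
    (tendsto_superpose_sum_single hG c hj)

theorem cosProd_superpose_sum_single_sub (I : Finset ι) (c : ι → ℤ) (j : ι → A) (a : A) :
    cosProd (superpose G (∑ i ∈ I, Finsupp.single (j i - a) (c i))) =
      cosProd (superpose G (∑ i ∈ I, Finsupp.single (j i) (c i))) := by
  rw [← cosProd_translate a]
  congr 1
  funext k
  simp only [superpose_sum_single, translate_apply, Finset.sum_apply, Pi.smul_apply, sub_sub,
    add_sub_cancel]

/-- The indices `i` for which `j i n - j i₀ n` stays bounded form a cluster around `i₀`. The other
ones escape from it, and their contribution decouples. -/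
theorem exists_tendsto_cosProd_superpose (U : Ultrafilter α) (hG : Summable G) (c : ι → ℤ)
    (j : ι → α → A) (I : Finset ι) : ∃ L : Multiset (A →₀ ℤ),
      Tendsto (fun n => cosProd (superpose G (∑ i ∈ I, Finsupp.single (j i n) (c i)))) U
        (𝓝 (L.map fun b => cosProd (superpose G b)).prod) := by
  classical
  induction I using Finset.strongInduction with
  | H I ih =>
    rcases I.eq_empty_or_nonempty with rfl | ⟨i₀, hi₀⟩
    · exact ⟨0, by simp [cosProd]⟩
    obtain ⟨C, hCI, d, hC, hfar⟩ :=
      exists_subset_eventually_eq_and_tendsto_cofinite U (fun i n => j i n - j i₀ n) I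
    have hi₀C : i₀ ∈ C := by
      by_contra h
      have hlim := hfar i₀ (Finset.mem_sdiff.2 ⟨hi₀, h⟩)
      obtain ⟨n, hn⟩ := (hlim.eventually (Set.finite_singleton 0).eventually_cofinite_notMem).exists
      exact hn (sub_self _)
    obtain ⟨L, hL⟩ := ih (I \ C) (Finset.sdiff_ssubset hCI ⟨i₀, hi₀C⟩)
    let a := ∑ i ∈ C, Finsupp.single (d i) (c i)
    refine ⟨a ::ₘ L, ?_⟩
    have hlim := (tendsto_cosProd_add_superpose_sub_mul (summable_superpose hG a) hG c hfar).add
      (hL.const_mul (cosProd (superpose G a)))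
    rw [zero_add] at hlim
    rw [Multiset.map_cons, Multiset.prod_cons]
    refine hlim.congr' (hC.mono fun n hn => ?_)
    have ha : a = ∑ i ∈ C, Finsupp.single (j i n - j i₀ n) (c i) :=
      Finset.sum_congr rfl fun i hi => by rw [← hn i hi]
    rw [cosProd_superpose_sum_single_sub (I \ C), sub_add_cancel, ← map_add, ha,
      add_comm, Finset.sum_sdiff hCI, cosProd_superpose_sum_single_sub]

end Clusters

section HalfLineClusters

open scoped translate

variable {α ι : Type*} {θ : ℝ} {G : ℤ → ℝ}

theorem tsum_abs_sum_smul_le {κ : Type*} {I : Finset ι} (c : ι → ℝ) {f : ι → κ → ℝ}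
    (hf : ∀ i ∈ I, Summable (f i)) :
    ∑' k, |(∑ i ∈ I, c i • f i) k| ≤ ∑ i ∈ I, |c i| * ∑' k, |f i k| := by
  have hs : ∀ i ∈ I, Summable fun k => |c i| * |f i k| := fun i hi => (hf i hi).abs.mul_left _
  have hle : ∀ k, |(∑ i ∈ I, c i • f i) k| ≤ ∑ i ∈ I, |c i| * |f i k| := fun k => by
    simp only [Finset.sum_apply, Pi.smul_apply, smul_eq_mul, ← abs_mul]
    exact Finset.abs_sum_le_sum_abs _ _
  simp only [← tsum_mul_left]
  rw [← Summable.tsum_finsetSum hs]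
  exact ((summable_sum hs).of_nonneg_of_le (fun _ => abs_nonneg _) hle).tsum_le_tsum hle
    (summable_sum hs)

theorem tendsto_tsum_abs_halfLineProj_translate_sub {l : Filter α} (hθ : 1 < θ) (hG : Summable G)
    {j : α → ℤ} (hj : Tendsto j l atTop) :
    Tendsto (fun n => ∑' k, |(halfLineProj θ (τ (j n) G) - τ (j n) G) k|) l (𝓝 0) := by
  have hinj : Function.Injective fun j : ℤ => 0 - j := sub_right_injective
  have hcorr : Tendsto (fun n => -τ (j n) G 0) l (𝓝 0) := by
    simpa using (hG.tendsto_cofinite_zero.comp (hinj.tendsto_cofinite.comp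
      (hj.mono_right atTop_le_cofinite))).neg
  simpa only [halfLineProj_apply, neg_smul, ← sub_eq_add_neg] using
    tendsto_tsum_abs_indicator_translate_add_smul_sub hG (summable_halfGeom hθ) hj hcorr

theorem tendsto_tsum_abs_halfLineProj_superpose_sub {l : Filter α} (hθ : 1 < θ) (hG : Summable G)
    {I : Finset ι} (c : ι → ℤ) {j : ι → α → ℤ} (hj : ∀ i ∈ I, Tendsto (j i) l atTop) :
    Tendsto (fun n => ∑' k, |(halfLineProj θ (superpose G (∑ i ∈ I, Finsupp.single (j i n) (c i))) -
      superpose G (∑ i ∈ I, Finsupp.single (j i n) (c i))) k|) l (𝓝 0) := by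
  have hterm := tendsto_finsetSum I fun i hi =>
    (tendsto_tsum_abs_halfLineProj_translate_sub hθ hG (hj i hi)).const_mul |(c i : ℝ)|
  simp only [mul_zero, Finset.sum_const_zero] at hterm
  refine squeeze_zero (fun n => tsum_nonneg fun k => abs_nonneg _) (fun n => ?_) hterm
  have hsum : halfLineProj θ (superpose G (∑ i ∈ I, Finsupp.single (j i n) (c i))) -
      superpose G (∑ i ∈ I, Finsupp.single (j i n) (c i)) =
        ∑ i ∈ I, (c i : ℝ) • (halfLineProj θ (τ (j i n) G) - τ (j i n) G) := by
    simp only [superpose_sum_single]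
    rw [map_sum, ← Finset.sum_sub_distrib]
    exact Finset.sum_congr rfl fun i _ => by rw [map_smul, smul_sub]
  rw [hsum]
  exact tsum_abs_sum_smul_le (f := fun i => halfLineProj θ (τ (j i n) G) - τ (j i n) G) _ fun i _ =>
    (summable_halfLineProj hθ (summable_translate hG _)).sub (summable_translate hG _)

theorem tendsto_atTop_of_tendsto_cofinite_of_nonneg {l : Filter α} {j : α → ℤ}
    (hj : Tendsto j l cofinite) (h0 : ∀ᶠ n in l, 0 ≤ j n) : Tendsto j l atTop := by
  refine tendsto_atTop.2 fun b => ?_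
  filter_upwards [h0, hj.eventually (Set.finite_Icc 0 b).eventually_cofinite_notMem] with n h1 h2
  exact (not_le.1 fun h => h2 ⟨h1, h⟩).le

theorem exists_tendsto_cosProd_halfLineProj_superpose (U : Ultrafilter α) (hθ : 1 < θ)
    (hG : Summable G) (c : ι → ℤ) (j : ι → α → ℤ) (I : Finset ι)
    (hj : ∀ᶠ n in U, ∀ i ∈ I, 0 ≤ j i n) : ∃ (a : ℤ →₀ ℤ) (L : Multiset (ℤ →₀ ℤ)),
      Tendsto (fun n => cosProd (halfLineProj θ (superpose G
        (∑ i ∈ I, Finsupp.single (j i n) (c i))))) U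
        (𝓝 (cosProd (halfLineProj θ (superpose G a)) *
          (L.map fun b => cosProd (superpose G b)).prod)) := by
  classical
  obtain ⟨C, hCI, d, hC, hfar⟩ := exists_subset_eventually_eq_and_tendsto_cofinite U j I
  obtain ⟨L, hL⟩ := exists_tendsto_cosProd_superpose U hG c j (I \ C)
  let a := ∑ i ∈ C, Finsupp.single (d i) (c i)
  let b : α → ℤ →₀ ℤ := fun n => ∑ i ∈ I \ C, Finsupp.single (j i n) (c i)
  refine ⟨a, L, ?_⟩
  set u := halfLineProj θ (superpose G a)
  have hu : Summable u := summable_halfLineProj hθ (summable_superpose hG a)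
  have hproj : Tendsto (fun n => cosProd (u + halfLineProj θ (superpose G (b n))) -
      cosProd (u + superpose G (b n))) U (𝓝 0) := by
    refine tendsto_cosProd_sub
      (fun n => hu.add (summable_halfLineProj hθ (summable_superpose hG (b n))))
      (fun n => hu.add (summable_superpose hG (b n))) ?_
    simpa only [b, Pi.add_apply, Pi.sub_apply, add_sub_add_left_eq_sub] using
      tendsto_tsum_abs_halfLineProj_superpose_sub hθ hG c fun i hi =>
        tendsto_atTop_of_tendsto_cofinite_of_nonneg (hfar i hi)
          (hj.mono fun n hn => hn i (Finset.sdiff_subset hi))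
  have hlim := (hproj.add (tendsto_cosProd_add_superpose_sub_mul hu hG c hfar)).add
    (hL.const_mul (cosProd u))
  rw [zero_add, zero_add] at hlim
  refine hlim.congr' (hC.mono fun n hn => ?_)
  have ha : a = ∑ i ∈ C, Finsupp.single (j i n) (c i) :=
    Finset.sum_congr rfl fun i hi => by rw [← hn i hi]
  rw [sub_add_sub_cancel, sub_add_cancel, ← map_add, ← map_add, ha, add_comm,
    Finset.sum_sdiff hCI]

end HalfLineClusters

/-! ### Countability of the limit points -/

section Countable

variable {θ : ℝ} {G : ℤ → ℝ}

theorem exists_abs_eq_of_tendsto_cosProd (hθ : IsPisot θ) (hG : Summable G)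
    (hGr : recur θ G = Pi.single 0 1) (U : Ultrafilter ℤ) {x : ℝ} (hx0 : x ≠ 0)
    (hx : Tendsto (fun n : ℤ => cosProd ((2 * n : ℝ) • halfGeom θ)) U (𝓝 x)) :
    ∃ (a : ℤ →₀ ℤ) (L : Multiset (ℤ →₀ ℤ)), |x| = |cosProd (halfLineProj θ (superpose G a)) *
      (L.map fun b => cosProd (superpose G b)).prod| := by
  have hpos : 0 < |x| := abs_pos.2 hx0
  obtain ⟨m, B, h⟩ := exists_abs_cosProd_eq_halfLineProj_superpose hθ hG hGr (half_pos hpos)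
  choose! b hm hB h0 hb using h
  have hev : ∀ᶠ n : ℤ in U, |x| / 2 ≤ |cosProd ((2 * n : ℝ) • halfGeom θ)| :=
    hx.abs.eventually_const_le (half_lt_self hpos)
  obtain ⟨r, c, j, hj⟩ := exists_eventually_eq_sum_single U b (Set.finite_Icc (-(B : ℤ)) B)
    (hev.mono hm) (hev.mono fun n hn k => abs_le.1 (hB n hn k))
  obtain ⟨a, L, hlim⟩ := exists_tendsto_cosProd_halfLineProj_superpose U hθ.1 hG c j Finset.univ
    (by filter_upwards [hev, hj] with n hn hjn i _ using h0 n hn _ (hjn.1 i))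
  refine ⟨a, L, tendsto_nhds_unique hx.abs (hlim.abs.congr' ?_)⟩
  filter_upwards [hev, hj] with n hn hjn
  rw [hb n hn, hjn.2]

theorem exists_tendsto_cosProd_of_mem_limitPoints (hθ : 1 < θ) {z : ℂ}
    (hz : z ∈ limitPoints (measureFourierCoeff (circleBernoulli θ))) :
    ∃ (x : ℝ) (U : Ultrafilter ℤ), (x : ℂ) = z ∧
      Tendsto (fun n : ℤ => cosProd ((2 * n : ℝ) • halfGeom θ)) U (𝓝 x) := by
  obtain ⟨U, -, hU⟩ := mapClusterPt_iff_ultrafilter.1 (mem_limitPoints_iff.1 hz)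
  replace hU := hU.congr (measureFourierCoeff_eq_cosProd hθ)
  obtain ⟨x, rfl⟩ := Complex.isometry_ofReal.isClosedEmbedding.isClosed_range.mem_of_tendsto hU
    (.of_forall fun n => Set.mem_range_self _)
  exact ⟨x, U, rfl, tendsto_ofReal_iff.1 hU⟩

theorem limitPoints_countable (hθ : IsPisot θ) :
    (limitPoints (measureFourierCoeff (circleBernoulli θ))).Countable := by
  obtain ⟨G, hG, hGr⟩ := exists_summable_recur_eq_single hθ
  let w : (ℤ →₀ ℤ) × Multiset (ℤ →₀ ℤ) → ℝ := fun p =>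
    cosProd (halfLineProj θ (superpose G p.1)) * (p.2.map fun b => cosProd (superpose G b)).prod
  have hcount : ({0} ∪ (Set.range w ∪ Set.range (-w))).Countable :=
    (Set.countable_singleton 0).union ((Set.countable_range w).union (Set.countable_range (-w)))
  refine (hcount.image ((↑) : ℝ → ℂ)).mono fun z hz => ?_
  obtain ⟨x, U, rfl, hx⟩ := exists_tendsto_cosProd_of_mem_limitPoints hθ.1 hz
  refine Set.mem_image_of_mem _ (or_iff_not_imp_left.2 fun hx0 => ?_)
  obtain ⟨a, L, habs⟩ := exists_abs_eq_of_tendsto_cosProd hθ hG hGr U hx0 hx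
  exact (abs_eq_abs.1 habs).imp (fun h => ⟨(a, L), h.symm⟩) fun h => ⟨(a, L), h.symm⟩

end Countable

end BernoulliConv

end

theorem theorem1 (θ : ℝ) (hθ : BernoulliConv.IsPisot θ) (hirr : Irrational θ) :
    (BernoulliConv.limitPoints
        (BernoulliConv.measureFourierCoeff (BernoulliConv.circleBernoulli θ))).Countable ∧
      (BernoulliConv.limitPoints
        (BernoulliConv.measureFourierCoeff (BernoulliConv.circleBernoulli θ))).Infinite ∧
      ∀ (p : ℝ≥0∞) [Fact (1 ≤ p)], 1 < p → p < ∞ →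
        spectrum ℂ (BernoulliConv.convOp (BernoulliConv.circleBernoulli θ) p) =
            spectrum ℂ (BernoulliConv.convOp (BernoulliConv.circleBernoulli θ) 2) ∧
          spectrum ℂ (BernoulliConv.convOp (BernoulliConv.circleBernoulli θ) 2) =
            closure (Set.range
              (BernoulliConv.measureFourierCoeff (BernoulliConv.circleBernoulli θ))) := by
  have hcount := BernoulliConv.limitPoints_countable hθ
  have hclosure := ((Set.countable_range (BernoulliConv.measureFourierCoeff
    (BernoulliConv.circleBernoulli θ))).union hcount).mono (BernoulliConv.closure_range_subset _)
  have h2 := BernoulliConv.spectrum_convOp_eq_closure_range (BernoulliConv.circleBernoulli θ)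
    hclosure (p := 2) ENNReal.one_lt_two ENNReal.ofNat_ne_top
  refine ⟨hcount, BernoulliConv.limitPoints_infinite hθ hirr, fun p _ h1p hp => ⟨?_, h2⟩⟩
  exact (BernoulliConv.spectrum_convOp_eq_closure_range _ hclosure h1p hp.ne).trans h2.symm
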